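/- Setting. For a real square matrix $A$ let $\|A\|$ and $\|A\|_{\rm F}$ be its operator and Frobenius norms, and for a nonzero positive semidefinite $A$ let $\mathtt r(A)={\rm Tr}(A)/\|A\|$. Let $X_1,\dots,X_n$ be i.i.d. copies of a random vector $X$ in $\mathbb R^d$ with $\mathbb E X=0$, $\mathbb E XX^\top=\Sigma$, $\Sigma$ invertible, and put $\widehat\Sigma=\frac1n\sum_{i=1}^n X_iX_i^\top$ and $\xi=\Sigma^{-1/2}X$. For $U\in\mathbb R^{d\times d}$ with $\mathbb E e^{\xi^\top U\xi}<\infty$ let $\mathsf P_U f=\mathbb E[f(\xi)e^{\xi^\top U\xi}]/\mathbb E e^{\xi^\top U\xi}$. Assume (Assumption 1, with parameters $\tau,\rho_{\max}>0$) that for all $U$ with $\|U\|_{\rm F}\le\rho_{\max}$ the moment $\mathbb E e^{\xi^\top U\xi}$ is finite and $$\mathsf P_U\big(\xi^\top V\xi-\mathsf P_U\,\xi^\top V\xi\big)^4\le\tau^2\|V\|_{\rm F}^4\qquad\text{for all }V\in\mathbb R^{d\times d}.$$ Theorem. For every $\tau>0$ there is a constant $C>0$ depending only on $\tau$ such that for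 every $\rho_{\max}>0$ the following holds. (i) There is $c>0$, depending only on $\tau$ and $\rho_{\max}$, such that for all $d$, $n$ and all samples as above, $\|\widehat\Sigma-\Sigma\|_{\rm F}^2$ is integrable, its mean is positive if $\mathtt r(\Sigma)>1$, and for every $\delta\in(0,1)$ with $n\ge c\,\big(\mathtt r(\Sigma)^6+\mathtt r(\Sigma)^2\log^2(2/\delta)\big)$ one has, with probability at least $1-\delta$, $$\Big|\|\widehat\Sigma-\Sigma\|_{\rm F}^2-\mathbb E\|\widehat\Sigma-\Sigma\|_{\rm F}^2\Big|\le C\,\frac{\|\Sigma\|^2}{n}\max\Big\{\mathtt r(\Sigma^2)\sqrt{\log(7/\delta)},\ \log(7/\delta)\Big\};$$ if moreover $\mathtt r(\Sigma)>1$, then each of the following two bounds also holds with probability at least $1-\delta$: $$\Big|\frac{\|\widehat\Sigma-\Sigma\|_{\rm F}^2}{\mathbb E\|\widehat\Sigma-\Sigma\|_{\rm F}^2}-1\Big|\le C\max\Big\{\frac{\mathtt r(\Sigma^2)\sqrt{\log(7/\delta)}}{\mathtt r(\Sigma)^2-\mathtt r(\Sigma^2)},\ \frac{\log(7/\delta)}{\mathtt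 r(\Sigma)^2-\mathtt r(\Sigma^2)}\Big\},$$ $$\Big|\frac{\|\widehat\Sigma-\Sigma\|_{\rm F}^2}{\mathbb E\|\widehat\Sigma-\Sigma\|_{\rm F}^2}-1\Big|\le C\max\Big\{\frac{\sqrt{\log(7/\delta)}}{\mathtt r(\Sigma)-1},\ \frac{\log(7/\delta)}{\mathtt r(\Sigma)(\mathtt r(\Sigma)-1)}\Big\}.$$ (ii) As $\mathtt r(\Sigma)$ and $n/\mathtt r(\Sigma)^6$ tend to infinity, $\|\widehat\Sigma-\Sigma\|_{\rm F}^2/\mathbb E\|\widehat\Sigma-\Sigma\|_{\rm F}^2=1+\mathcal O(1/\mathtt r(\Sigma))$ in probability, uniformly over the model: for every $\delta\in(0,1)$ there is $R$, depending only on $\tau,\rho_{\max},\delta$, such that for all $d$, $n$ and all samples as above with $\mathtt r(\Sigma)\ge R$ and $n/\mathtt r(\Sigma)^6\ge R$, the mean $\mathbb E\|\widehat\Sigma-\Sigma\|_{\rm F}^2$ is positive and, with probability at least $1-\delta$, $$\Big|\frac{\|\widehat\Sigma-\Sigma\|_{\rm F}^2}{\mathbb E\|\widehat\Sigma-\Sigma\|_{\rm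 F}^2}-1\Big|\le \frac{C\sqrt{\log(7/\delta)}}{\mathtt r(\Sigma)}.$$ -/

import Mathlib

universe u

namespace SampleCov

open MeasureTheory ProbabilityTheory

/-- The Frobenius norm of a real square matrix. -/
noncomputable def frobNorm {d : ℕ} (A : Matrix (Fin d) (Fin d) ℝ) : ℝ :=
  letI := Matrix.frobeniusNormedAddCommGroup (m := Fin d) (n := Fin d) (α := ℝ)
  ‖A‖

/-- The operator norm of a real square matrix acting on Euclidean space. -/
noncomputable def opNorm {d : ℕ} (A : Matrix (Fin d) (Fin d) ℝ) : ℝ :=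
  letI := Matrix.instL2OpNormedAddCommGroup (m := Fin d) (n := Fin d) (𝕜 := ℝ)
  ‖A‖

/-- The effective rank `Tr(A) / ‖A‖` of a nonzero positive semidefinite matrix. -/
noncomputable def effRank {d : ℕ} (A : Matrix (Fin d) (Fin d) ℝ) : ℝ :=
  A.trace / opNorm A

/-- The quadratic form `xᵀ U x`. -/
def quadForm {d : ℕ} (U : Matrix (Fin d) (Fin d) ℝ) (x : Fin d → ℝ) : ℝ :=
  x ⬝ᵥ (U.mulVec x)

open scoped MatrixOrder in
/-- The whitening map `x ↦ Σ^{-1/2} x`. -/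
noncomputable def whiten {d : ℕ} (S : Matrix (Fin d) (Fin d) ℝ) (x : Fin d → ℝ) : Fin d → ℝ :=
  (CFC.sqrt S)⁻¹.mulVec x

/-- The measure `P_U`: the law `ν` of `ξ`, exponentially tilted by the quadratic form of `U`, i.e.
`dP_U(x) = exp(xᵀ U x) / E exp(ξᵀ U ξ) dν(x)`. -/
noncomputable def tiltedLaw {d : ℕ} (ν : Measure (Fin d → ℝ)) (U : Matrix (Fin d) (Fin d) ℝ) :
    Measure (Fin d → ℝ) :=
  ν.tilted (quadForm U)

/-- The regularity assumption on the law `ν` of the whitened vector `ξ`: for every `U` with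
`‖U‖_F ≤ ρ` the tilted measure `P_U` is well defined (the exponential moment is finite), and the
fourth central moment of `ξᵀ V ξ` under `P_U` exists and is at most `τ² ‖V‖_F⁴` for every `V`. -/
def TiltedFourthMomentBound {d : ℕ} (ν : Measure (Fin d → ℝ)) (τ ρ : ℝ) : Prop :=
  ∀ U : Matrix (Fin d) (Fin d) ℝ, frobNorm U ≤ ρ →
    Integrable (fun x => Real.exp (quadForm U x)) ν ∧
    ∀ V : Matrix (Fin d) (Fin d) ℝ,
      Integrable (quadForm V) (tiltedLaw ν U) ∧
      Integrable (fun x => (quadForm V x - ∫ y, quadForm V y ∂(tiltedLaw ν U)) ^ 4)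
        (tiltedLaw ν U) ∧
      ∫ x, (quadForm V x - ∫ y, quadForm V y ∂(tiltedLaw ν U)) ^ 4 ∂(tiltedLaw ν U)
        ≤ τ ^ 2 * frobNorm V ^ 4

/-- `μ` is a law on `ℝᵈ` with finite second moments, mean zero, and covariance matrix `S`. -/
structure IsCenteredLaw {d : ℕ} (μ : Measure (Fin d → ℝ)) (S : Matrix (Fin d) (Fin d) ℝ) :
    Prop where
  prob : IsProbabilityMeasure μ
  memLp : ∀ i, MemLp (fun x : Fin d → ℝ => x i) 2 μ
  mean_zero : ∀ i, ∫ x, x i ∂μ = 0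
  cov_eq : ∀ i j, ∫ x, x i * x j ∂μ = S i j

/-- `X 0, …, X (n - 1)` are i.i.d. random vectors with common law `μ`; this law is centered with
invertible covariance matrix `S`, and the whitened vector satisfies the regularity assumption with
parameters `τ` and `ρ`. -/
structure IsRegularSample {d n : ℕ} {Ω : Type*} [MeasurableSpace Ω] (P : Measure Ω)
    (X : Fin n → Ω → (Fin d → ℝ)) (μ : Measure (Fin d → ℝ)) (S : Matrix (Fin d) (Fin d) ℝ)
    (τ ρ : ℝ) : Prop where
  prob : IsProbabilityMeasure P
  hasLaw : ∀ k, HasLaw (X k) μ P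
  indep : iIndepFun X P
  centered : IsCenteredLaw μ S
  posDef : S.PosDef
  regular : TiltedFourthMomentBound (μ.map (whiten S)) τ ρ

/-- The sample covariance `(1/n) ∑ X_k X_kᵀ`. -/
noncomputable def sampleCov {d n : ℕ} {Ω : Type*} (X : Fin n → Ω → (Fin d → ℝ)) (ω : Ω) :
    Matrix (Fin d) (Fin d) ℝ :=
  (1 / (n : ℝ)) • ∑ k, Matrix.vecMulVec (X k ω) (X k ω)

/-- The squared Frobenius error of the sample covariance. -/
noncomputable def sqErr {d n : ℕ} {Ω : Type*} (X : Fin n → Ω → (Fin d → ℝ))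
    (S : Matrix (Fin d) (Fin d) ℝ) (ω : Ω) : ℝ :=
  frobNorm (sampleCov X ω - S) ^ 2

/-- The mean squared Frobenius error of the sample covariance. -/
noncomputable def meanSqErr {d n : ℕ} {Ω : Type*} [MeasurableSpace Ω] (P : Measure Ω)
    (X : Fin n → Ω → (Fin d → ℝ)) (S : Matrix (Fin d) (Fin d) ℝ) : ℝ :=
  ∫ ω, sqErr X S ω ∂P

end SampleCov

namespace SampleCov

open MeasureTheory ProbabilityTheory
open scoped ENNReal RealInnerProductSpace Matrix

/-! Put $B_k=\xi_k\xi_k^\top-I$, seen as a vector of the Euclidean space of matrices, and let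
$Q=\Sigma^{1/2}/\|\Sigma\|^{1/2}$. The map $SV=QVQ$ is a self-adjoint contraction for the Frobenius
norm, and $\|\widehat\Sigma-\Sigma\|_F^2=\frac{\|\Sigma\|^2}{n}\cdot\frac1n\|\sum_k SB_k\|^2$
(`sqErr_eq`). So everything reduces to the squared norm of a sum of independent vectors, treated in
`measure_sq_norm_sum_sub_le`.

The assumption enters twice. At $U=0$ it bounds fourth moments. For general $U$ it bounds the
variance of $\xi^\top V\xi$ under the tilted law, which is the second derivative of a cumulant
generating function; hence $\langle B_k,U\rangle$ has a sub-gaussian Laplace transform for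
$\|U\|_F\le\rho/2$ (`mgf_centeredQuad_le`).

Expanding the square gives $\sum_k\|SB_k\|^2+2\sum_k\langle B_k,N_k\rangle$ with
$N_k=\sum_{j<k}S^2B_j$. The diagonal part obeys Bernstein's inequality, because its summands have
second moment at most $n$ and rarely exceed $n$. The other part is a martingale transform, and local
sub-gaussianity controls it once $\|N_k\|\le R$ with $R^2$ of order $n(\mathtt
r(\Sigma^2)^2+\log(1/\delta))$.

That bound on $N_k$ is a bootstrap: $\|N_m\|^2$ has an expansion of the same kind, so one stops the
coefficients when they first exceed $R$, bounds the stopped transform, and concludes that the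
threshold is never crossed (`norm_partialSum_le_of_stopped`). The factor $\mathtt r(\Sigma^2)$,
rather than $\mathtt r(\Sigma)$, appears because $S^2$ is conjugation by $Q^2$ and
$\|Q^2\|_F^2=\mathtt r(\Sigma^2)$. There are seven exceptional events, which explains
$\log(7/\delta)$.

The relative bounds follow by dividing by the mean, for which Jensen's inequality gives a lower
bound proportional to $\mathtt r(\Sigma)^2-\mathtt r(\Sigma^2)$ (`le_integral_norm_conjMap_sq`). -/

lemma exp_le_one_add_add_sq {x : ℝ} (hx : x ≤ 1) : Real.exp x ≤ 1 + x + x ^ 2 := by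
  rcases le_or_gt (-1) x with h | h
  · have := abs_le.1 (Real.abs_exp_sub_one_sub_id_le (abs_le.2 ⟨h, hx⟩))
    linarith [this.2]
  · have : Real.exp x ≤ 1 := Real.exp_le_one_iff.2 (by linarith)
    nlinarith

/-! ### Chernoff and Bernstein bounds for sums of independent variables -/

section Tail

variable {Ω : Type*} [mΩ : MeasurableSpace Ω] {P : Measure Ω}

/-- Chernoff's bound in the form of Markov's inequality for an exponential. -/
lemma measure_lt_le_of_lintegral_exp_le_one {f : Ω → ℝ} (hf : Measurable f)
    (h : ∫⁻ ω, ENNReal.ofReal (Real.exp (f ω)) ∂P ≤ 1) (l : ℝ) :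
    P {ω | l < f ω} ≤ ENNReal.ofReal (Real.exp (-l)) := by
  have hm : AEMeasurable (fun ω => ENNReal.ofReal (Real.exp (f ω))) P := by fun_prop
  have key := mul_meas_ge_le_lintegral₀ hm (ENNReal.ofReal (Real.exp l))
  have hsub : {ω | l < f ω} ⊆
      {ω | ENNReal.ofReal (Real.exp l) ≤ ENNReal.ofReal (Real.exp (f ω))} := by
    intro ω hω
    exact ENNReal.ofReal_le_ofReal (Real.exp_le_exp.2 (le_of_lt hω))
  rw [Real.exp_neg, ENNReal.ofReal_inv_of_pos (Real.exp_pos _)]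
  have hpos : ENNReal.ofReal (Real.exp l) ≠ 0 := by simp [Real.exp_pos]
  rw [ENNReal.le_inv_iff_mul_le, mul_comm]
  calc _ ≤ _ := by gcongr
    _ ≤ _ := key
    _ ≤ 1 := h

/-- Bernstein's bound for a sum of independent variables that are bounded above by `1`. -/
lemma measure_sum_gt_le_of_le_one [IsProbabilityMeasure P] {n : ℕ} {g : Fin n → Ω → ℝ}
    (hm : ∀ k, Measurable (g k)) (hind : iIndepFun g P) (h1 : ∀ k ω, g k ω ≤ 1)
    (hi : ∀ k, Integrable (g k) P) (hi2 : ∀ k, Integrable (fun ω => g k ω ^ 2) P) {a b : ℝ}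
    (ha : ∀ k, ∫ ω, g k ω ∂P ≤ a) (hb : ∀ k, ∫ ω, g k ω ^ 2 ∂P ≤ b) (l : ℝ) :
    P {ω | l + n * (a + b) < ∑ k, g k ω} ≤ ENNReal.ofReal (Real.exp (-l)) := by
  have hexp : ∀ k, Integrable (fun ω => Real.exp (g k ω)) P := by
    intro k
    refine Integrable.of_bound (by have := hm k; fun_prop) (Real.exp 1) (ae_of_all _ fun ω => ?_)
    rw [Real.norm_eq_abs, abs_of_pos (Real.exp_pos _)]
    exact Real.exp_le_exp.2 (h1 k ω)
  have hmgf : ∀ k, mgf (g k) P 1 ≤ Real.exp (a + b) := by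
    intro k
    have hle : mgf (g k) P 1 ≤ ∫ ω, (1 + g k ω + g k ω ^ 2) ∂P := by
      refine integral_mono (by simpa using hexp k)
        (((integrable_const _).add (hi k)).add (hi2 k)) fun ω => ?_
      simpa using exp_le_one_add_add_sq (h1 k ω)
    have heq : ∫ ω, (1 + g k ω + g k ω ^ 2) ∂P = 1 + ∫ ω, g k ω ∂P + ∫ ω, g k ω ^ 2 ∂P := by
      have i1 : Integrable (fun ω => 1 + g k ω) P := (integrable_const _).add (hi k)
      rw [integral_add i1 (hi2 k), integral_add (integrable_const _) (hi k)]
      simp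
    have := Real.add_one_le_exp (a + b)
    linarith [ha k, hb k]
  have hprod : ∫ ω, Real.exp (∑ k, g k ω) ∂P ≤ Real.exp (n * (a + b)) := by
    have := hind.mgf_sum (t := 1) hm Finset.univ
    have h2 : ∫ ω, Real.exp (∑ k, g k ω) ∂P = ∏ k, mgf (g k) P 1 := by
      rw [← this]; simp [mgf]
    rw [h2]
    calc ∏ k, mgf (g k) P 1 ≤ ∏ _k : Fin n, Real.exp (a + b) :=
          Finset.prod_le_prod (fun k _ => mgf_nonneg) fun k _ => hmgf k
      _ = Real.exp (n * (a + b)) := by simp [← Real.exp_nat_mul]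
  have hint : Integrable (fun ω => Real.exp (∑ k, g k ω)) P := by
    have := hind.integrable_exp_mul_sum (t := 1) hm (s := Finset.univ)
      (fun k _ => by simpa using hexp k)
    simpa using this
  have := measure_lt_le_of_lintegral_exp_le_one (P := P)
    (f := fun ω => ∑ k, g k ω - n * (a + b)) (by fun_prop) ?_ l
  · convert this using 4
    constructor <;> intro h <;> linarith
  · rw [← ofReal_integral_eq_lintegral_ofReal _ (ae_of_all _ fun _ => (Real.exp_pos _).le)]
    · rw [ENNReal.ofReal_le_one]
      simp_rw [Real.exp_sub, integral_div]
      rwa [div_le_one (Real.exp_pos _)]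
    · simp_rw [Real.exp_sub]
      exact hint.div_const _

/-- Lower tail of a sum of independent nonnegative variables. -/
lemma measure_sum_lt_le_of_nonneg [IsProbabilityMeasure P] {n : ℕ} {F : Fin n → Ω → ℝ}
    (hm : ∀ k, Measurable (F k)) (hind : iIndepFun F P) (h0 : ∀ k ω, 0 ≤ F k ω)
    (hi : ∀ k, Integrable (F k) P) (hi2 : ∀ k, Integrable (fun ω => F k ω ^ 2) P) {m : ℝ}
    (ha : ∀ k, ∫ ω, F k ω ∂P = m) (hb : ∀ k, ∫ ω, F k ω ^ 2 ∂P ≤ n) (l : ℝ) :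
    P {ω | ∑ k, F k ω < n * (m - (l + 1))} ≤ ENNReal.ofReal (Real.exp (-l)) := by
  rcases Nat.eq_zero_or_pos n with rfl | hn
  · simp
  have hn' : (0 : ℝ) < n := by exact_mod_cast hn
  -- Since $-F_k/n\le0$, the lower tail needs no truncation. After division by $n$ the second
  -- moments add up to at most $1$, which is the $1$ in $l+1$.
  have := measure_sum_gt_le_of_le_one (P := P) (g := fun k ω => -(F k ω / n)) (a := -(m / n))
    (b := 1 / n) (fun k => ((hm k).div_const _).neg)
    (hind.comp (fun _ x => -(x / n)) fun _ => by fun_prop)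
    (fun k ω => by have := div_nonneg (h0 k ω) hn'.le; linarith)
    (fun k => ((hi k).div_const _).neg)
    (fun k => by simpa [div_pow] using (hi2 k).div_const ((n : ℝ) ^ 2))
    (fun k => by rw [integral_neg, integral_div, ha])
    (fun k => by
      simp only [even_two, Even.neg_pow, div_pow]
      rw [integral_div, div_le_div_iff₀ (by positivity) hn']
      nlinarith [hb k]) l
  refine le_trans (measure_mono fun ω hω => ?_) this
  simp only [Set.mem_ofPred_eq, Finset.sum_neg_distrib, ← Finset.sum_div] at hω ⊢
  have h3 : (∑ k, F k ω) / n < m - (l + 1) := by rw [div_lt_iff₀ hn']; linarith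
  have h4 : (n : ℝ) * (-(m / n) + 1 / n) = 1 - m := by field_simp; ring
  rw [h4]; linarith

/-- Upper tail of a sum of independent nonnegative variables that rarely exceed `n`. -/
lemma measure_sum_gt_le_of_nonneg [IsProbabilityMeasure P] {n : ℕ} {F : Fin n → Ω → ℝ}
    (hm : ∀ k, Measurable (F k)) (hind : iIndepFun F P) (h0 : ∀ k ω, 0 ≤ F k ω)
    (hi : ∀ k, Integrable (F k) P) (hi2 : ∀ k, Integrable (fun ω => F k ω ^ 2) P) {m : ℝ}
    (ha : ∀ k, ∫ ω, F k ω ∂P ≤ m) (hb : ∀ k, ∫ ω, F k ω ^ 2 ∂P ≤ n) (l : ℝ) :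
    P {ω | (∀ k, F k ω ≤ n) ∧ n * (m + (l + 1)) < ∑ k, F k ω} ≤
      ENNReal.ofReal (Real.exp (-l)) := by
  rcases Nat.eq_zero_or_pos n with rfl | hn
  · simp
  have hn' : (0 : ℝ) < n := by exact_mod_cast hn
  -- Rescaling by $n$ and replacing values above $n$ by zero makes the variables at most $1$ and
  -- only lowers their moments; on the event considered nothing is truncated.
  set c : ℝ → ℝ := fun x => if x ≤ n then x / n else 0 with hc
  have hcm : Measurable c :=
    Measurable.ite measurableSet_Iic (measurable_id.div_const _) measurable_const
  have hc0 : ∀ x, 0 ≤ x → 0 ≤ c x := fun x hx => by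
    simp only [hc]; split_ifs <;> positivity
  have hcle : ∀ x, 0 ≤ x → c x ≤ x / n := fun x hx => by
    simp only [hc]; split_ifs
    · exact le_rfl
    · positivity
  have hg : ∀ k, Integrable (fun ω => c (F k ω)) P := fun k =>
    ((hi k).div_const n).mono' (hcm.comp (hm k)).aestronglyMeasurable (ae_of_all _ fun ω => by
      rw [Real.norm_eq_abs, abs_of_nonneg (hc0 _ (h0 k ω))]; exact hcle _ (h0 k ω))
  have hsq : ∀ k ω, c (F k ω) ^ 2 ≤ F k ω ^ 2 / n ^ 2 := fun k ω => by
    rw [← div_pow]; exact pow_le_pow_left₀ (hc0 _ (h0 k ω)) (hcle _ (h0 k ω)) 2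
  have hg2 : ∀ k, Integrable (fun ω => c (F k ω) ^ 2) P := fun k =>
    ((hi2 k).div_const ((n : ℝ) ^ 2)).mono'
      ((hcm.comp (hm k)).pow_const 2).aestronglyMeasurable (ae_of_all _ fun ω => by
        rw [Real.norm_eq_abs, abs_of_nonneg (sq_nonneg _)]; exact hsq k ω)
  have := measure_sum_gt_le_of_le_one (P := P) (g := fun k ω => c (F k ω)) (a := m / n)
    (b := 1 / n) (fun k => hcm.comp (hm k)) (hind.comp (fun _ => c) fun _ => hcm)
    (fun k ω => by
      simp only [hc]; split_ifs with h
      · rwa [div_le_one hn']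
      · exact zero_le_one)
    hg hg2
    (fun k => by
      refine (integral_mono (hg k) ((hi k).div_const n) fun ω => hcle _ (h0 k ω)).trans ?_
      rw [integral_div]; gcongr; exact ha k)
    (fun k => by
      refine (integral_mono (hg2 k) ((hi2 k).div_const _) fun ω => hsq k ω).trans ?_
      rw [integral_div, div_le_div_iff₀ (by positivity) hn']
      nlinarith [hb k]) l
  refine le_trans (measure_mono fun ω hω => ?_) this
  obtain ⟨h1, h2⟩ := hω
  simp only [Set.mem_ofPred_eq]
  have h3 : ∑ k, c (F k ω) = (∑ k, F k ω) / n := by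
    rw [Finset.sum_div]
    exact Finset.sum_congr rfl fun k _ => by simp [hc, h1 k]
  have h4 : (n : ℝ) * (m / n + 1 / n) = 1 + m := by field_simp; ring
  rw [h3, h4, lt_div_iff₀ hn']; linarith

end Tail

/-! ### Predictable coefficients and stopping -/

section Past

variable {Ω H : Type*} [MeasurableSpace H]

/-- The σ-algebra generated by the variables with index less than `m`. -/
@[reducible]
def past {n : ℕ} (B : Fin n → Ω → H) (m : ℕ) : MeasurableSpace Ω :=
  ⨆ j ∈ {j : Fin n | j.val < m}, MeasurableSpace.comap (B j) inferInstance

lemma past_le [mΩ : MeasurableSpace Ω] {n : ℕ} {B : Fin n → Ω → H}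
    (hB : ∀ k, Measurable (B k)) (m : ℕ) :
    past B m ≤ mΩ :=
  iSup₂_le fun j _ => (hB j).comap_le

lemma past_mono {n : ℕ} (B : Fin n → Ω → H) {m m' : ℕ} (h : m ≤ m') : past B m ≤ past B m' :=
  biSup_mono fun _ hj => lt_of_lt_of_le hj h

lemma measurable_past {n : ℕ} (B : Fin n → Ω → H) {m : ℕ} {j : Fin n} (hj : j.val < m) :
    Measurable[past B m] (B j) :=
  (comap_measurable (B j)).mono
    (le_biSup (fun j => MeasurableSpace.comap (B j) inferInstance) hj) le_rfl

lemma indep_past [mΩ : MeasurableSpace Ω] {P : Measure Ω} {n : ℕ}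
    {B : Fin n → Ω → H} (hB : ∀ k, Measurable (B k)) (hind : iIndepFun B P)
    (k : Fin n) : Indep (past B k.val) (MeasurableSpace.comap (B k) inferInstance) P := by
  have := indep_iSup_of_disjoint (fun j => (hB j).comap_le) hind
    (S := {j : Fin n | j.val < k.val}) (T := {k}) (by simp)
  simpa [past] using this

end Past

section Stopped

variable {Ω H : Type*} [NormedAddCommGroup H]

/-- A predictable process, replaced by zero as soon as its norm has exceeded `R`. -/
noncomputable def stopped {n : ℕ} (N : Fin n → Ω → H) (R : ℝ) (k : Fin n) (ω : Ω) : H :=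
  open Classical in if ∀ j ≤ k, ‖N j ω‖ ≤ R then N k ω else 0

lemma norm_stopped_le {n : ℕ} (N : Fin n → Ω → H) {R : ℝ} (hR : 0 ≤ R) (k : Fin n) (ω : Ω) :
    ‖stopped N R k ω‖ ≤ R := by
  unfold stopped
  split_ifs with h
  · exact h k le_rfl
  · simpa

lemma stopped_of_forall {n : ℕ} {N : Fin n → Ω → H} {R : ℝ} {k : Fin n} {ω : Ω}
    (h : ∀ j ≤ k, ‖N j ω‖ ≤ R) : stopped N R k ω = N k ω := by
  unfold stopped; rw [if_pos h]

/-- The stopping condition at `k` involves only `N j` with `j ≤ k`, all known from the variables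
before `k`, so stopping preserves predictability. -/
lemma measurable_stopped [MeasurableSpace H] [OpensMeasurableSpace H] {n : ℕ} {B N : Fin n → Ω → H}
    (hN : ∀ k, Measurable[past B k.val] (N k)) (R : ℝ) (k : Fin n) :
    Measurable[past B k.val] (stopped N R k) := by
  have hs : MeasurableSet[past B k.val] {ω | ∀ j ≤ k, ‖N j ω‖ ≤ R} := by
    have : {ω | ∀ j ≤ k, ‖N j ω‖ ≤ R} = ⋂ j : Fin n, ⋂ (_ : j ≤ k), {ω | ‖N j ω‖ ≤ R} := by
      ext; simp
    rw [this]
    refine MeasurableSet.iInter fun j => MeasurableSet.iInter fun hj => ?_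
    have h1 := measurable_norm.comp ((hN j).mono (past_mono B hj) le_rfl)
    exact h1 measurableSet_Iic
  exact Measurable.ite hs (hN k) measurable_const

end Stopped

/-! ### Exponential supermartingale bound -/

section Martingale

variable {Ω : Type*} [mΩ : MeasurableSpace Ω] {P : Measure Ω}
  {H : Type*} [NormedAddCommGroup H] [InnerProductSpace ℝ H] [MeasurableSpace H] {τ ρ : ℝ}

/-- The centered law of `B` is sub-gaussian with variance proxy `τ` on the ball of radius `ρ`. -/
def LocallySubgaussian (B : Ω → H) (P : Measure Ω) (τ ρ : ℝ) : Prop :=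
  ∀ v : H, ‖v‖ ≤ ρ → ∫⁻ ω, ENNReal.ofReal (Real.exp (⟪B ω, v⟫ - τ / 2 * ‖v‖ ^ 2)) ∂P ≤ 1

variable [BorelSpace H] [SecondCountableTopology H]

lemma measurable_exp_inner_sub (τ : ℝ) : Measurable fun p : H × H =>
    ENNReal.ofReal (Real.exp (⟪p.1, p.2⟫ - τ / 2 * ‖p.2‖ ^ 2)) := by
  fun_prop

/-- By independence the joint law is a product, so `B` can be integrated out with `F` and `h`
frozen; the inner integral is at most $1$ by local sub-gaussianity at the frozen vector. -/
lemma lintegral_mul_exp_le {Ω : Type*} {m₁ : MeasurableSpace Ω} [mΩ : MeasurableSpace Ω]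
    {P : Measure Ω} [IsProbabilityMeasure P] (hm₁ : m₁ ≤ mΩ)
    {B : Ω → H}
    (hB : Measurable B) (hind : Indep m₁ (MeasurableSpace.comap B inferInstance) P)
    (hsub : LocallySubgaussian B P τ ρ) {F : Ω → ℝ≥0∞} (hF : Measurable[m₁] F)
    {h : Ω → H} (hh : Measurable[m₁] h) (hρ : ∀ ω, ‖h ω‖ ≤ ρ) :
    ∫⁻ ω, F ω * ENNReal.ofReal (Real.exp (⟪B ω, h ω⟫ - τ / 2 * ‖h ω‖ ^ 2)) ∂P ≤
      ∫⁻ ω, F ω ∂P := by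
  have hpm : Measurable[m₁] (fun ω => (F ω, h ω)) := hF.prodMk hh
  have hp : Measurable (fun ω => (F ω, h ω)) := hpm.mono hm₁ le_rfl
  have hif : IndepFun (fun ω => (F ω, h ω)) B P :=
    indep_of_indep_of_le_left hind hpm.comap_le
  have hprod := (indepFun_iff_map_prod_eq_prod_map_map hp.aemeasurable hB.aemeasurable).1 hif
  have : IsProbabilityMeasure (P.map B) := Measure.isProbabilityMeasure_map hB.aemeasurable
  set Φ : (ℝ≥0∞ × H) × H → ℝ≥0∞ := fun z =>
    z.1.1 * ENNReal.ofReal (Real.exp (⟪z.2, z.1.2⟫ - τ / 2 * ‖z.1.2‖ ^ 2)) with hΦ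
  have hΦm : Measurable Φ := by
    refine measurable_fst.fst.mul (ENNReal.measurable_ofReal.comp (Real.measurable_exp.comp ?_))
    have h1 : Measurable (fun z : (ℝ≥0∞ × H) × H => z.1.2) := measurable_fst.snd
    exact (measurable_snd.inner h1).sub ((h1.norm.pow_const 2).const_mul _)
  calc ∫⁻ ω, F ω * ENNReal.ofReal (Real.exp (⟪B ω, h ω⟫ - τ / 2 * ‖h ω‖ ^ 2)) ∂P
      = ∫⁻ z, Φ z ∂(P.map (fun ω => ((F ω, h ω), B ω))) := by
        rw [lintegral_map hΦm (hp.prodMk hB)]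
    _ = ∫⁻ z, ∫⁻ b, Φ (z, b) ∂(P.map B) ∂(P.map fun ω => (F ω, h ω)) := by
        rw [hprod, lintegral_prod _ hΦm.aemeasurable]
    _ = ∫⁻ ω, ∫⁻ b, Φ ((F ω, h ω), b) ∂(P.map B) ∂P := by
        rw [lintegral_map hΦm.lintegral_prod_right' hp]
    _ ≤ ∫⁻ ω, F ω ∂P := by
        refine lintegral_mono fun ω => ?_
        have hmb : Measurable fun b : H =>
            ENNReal.ofReal (Real.exp (⟪b, h ω⟫ - τ / 2 * ‖h ω‖ ^ 2)) := by fun_prop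
        simp only [hΦ]
        rw [lintegral_const_mul _ hmb, lintegral_map hmb hB]
        exact mul_le_of_le_one_right' (hsub _ (hρ ω))

/-- The exponential is a product over the indices. The factor of largest index is removed first, as
the remaining ones are measurable with respect to its past. -/
lemma lintegral_exp_sum_le_one [IsProbabilityMeasure P] {n : ℕ} {B : Fin n → Ω → H}
    (hB : ∀ k, Measurable (B k)) (hind : iIndepFun B P)
    (hsub : ∀ k, LocallySubgaussian (B k) P τ ρ) {h : Fin n → Ω → H}
    (hh : ∀ k, Measurable[past B k.val] (h k)) (hρ : ∀ k ω, ‖h k ω‖ ≤ ρ) :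
    ∫⁻ ω, ENNReal.ofReal (Real.exp (∑ k, (⟪B k ω, h k ω⟫ - τ / 2 * ‖h k ω‖ ^ 2))) ∂P ≤ 1 := by
  set g : Fin n → Ω → ℝ≥0∞ := fun k ω =>
    ENNReal.ofReal (Real.exp (⟪B k ω, h k ω⟫ - τ / 2 * ‖h k ω‖ ^ 2)) with hg
  have hgm : ∀ m, ∀ k : Fin n, k.val < m → Measurable[past B m] (g k) := by
    intro m k hk
    have h1 := measurable_past B hk
    have h2 := (hh k).mono (past_mono B hk.le) le_rfl
    exact (measurable_exp_inner_sub τ).comp (h1.prodMk h2)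
  have key : ∀ m : ℕ,
      ∫⁻ ω, ∏ k ∈ Finset.univ.filter (fun k : Fin n => k.val < m), g k ω ∂P ≤ 1 := by
    intro m
    induction m with
    | zero => simp
    | succ m ih =>
      by_cases hmn : m < n
      · have hins : Finset.univ.filter (fun k : Fin n => k.val < m + 1) =
            insert ⟨m, hmn⟩ (Finset.univ.filter (fun k : Fin n => k.val < m)) := by
          ext k; simp [Fin.ext_iff]; omega
        rw [hins]
        refine le_trans (le_of_eq ?_) ((lintegral_mul_exp_le (past_le hB m) (hB ⟨m, hmn⟩)
          (indep_past hB hind ⟨m, hmn⟩) (hsub _) (F := fun ω => ∏ k ∈ Finset.univ.filter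
            (fun k : Fin n => k.val < m), g k ω) ?_ (hh ⟨m, hmn⟩) (hρ _)).trans ih)
        · refine lintegral_congr fun ω => ?_
          rw [Finset.prod_insert (by simp), mul_comm]
        · exact Finset.measurable_fun_prod _ fun k hk => hgm m k (by simpa using hk)
      · have heq : Finset.univ.filter (fun k : Fin n => k.val < m + 1) =
            Finset.univ.filter (fun k : Fin n => k.val < m) := by
          ext k; have := k.2; simp; omega
        rwa [heq]
  refine le_trans (le_of_eq (lintegral_congr fun ω => ?_)) (key n)
  rw [Real.exp_sum, ENNReal.ofReal_prod_of_nonneg fun _ _ => (Real.exp_pos _).le]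
  refine Finset.prod_congr ?_ fun _ _ => rfl
  ext k; simp

/-- Tail bound for a martingale transform with bounded predictable coefficients. -/
lemma measure_sum_inner_gt_le [IsProbabilityMeasure P] {n : ℕ} {B : Fin n → Ω → H}
    (hB : ∀ k, Measurable (B k)) (hind : iIndepFun B P)
    (hsub : ∀ k, LocallySubgaussian (B k) P τ ρ) (hτ : 0 ≤ τ) {h : Fin n → Ω → H}
    (hh : ∀ k, Measurable[past B k.val] (h k)) {R θ : ℝ} (hR : ∀ k ω, ‖h k ω‖ ≤ R)
    (hθ : |θ| * R ≤ ρ) (l : ℝ) :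
    P {ω | l + n * (τ / 2 * (θ ^ 2 * R ^ 2)) < θ * ∑ k, ⟪B k ω, h k ω⟫} ≤
      ENNReal.ofReal (Real.exp (-l)) := by
  have hh' : ∀ k, Measurable[past B k.val] (fun ω => θ • h k ω) := fun k => (hh k).const_smul θ
  have hhm : ∀ k, Measurable (fun ω => θ • h k ω) := fun k => (hh' k).mono (past_le hB _) le_rfl
  have h1 := lintegral_exp_sum_le_one hB hind hsub hh' (fun k ω => by
    rw [norm_smul, Real.norm_eq_abs]
    exact (mul_le_mul_of_nonneg_left (hR k ω) (abs_nonneg _)).trans hθ)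
  refine le_trans (measure_mono fun ω hω => ?_) (measure_lt_le_of_lintegral_exp_le_one
    (f := fun ω => ∑ k, (⟪B k ω, θ • h k ω⟫ - τ / 2 * ‖θ • h k ω‖ ^ 2)) ?_ h1 l)
  · simp only [Set.mem_ofPred_eq] at hω ⊢
    have h2 : ∑ k, τ / 2 * ‖θ • h k ω‖ ^ 2 ≤ n * (τ / 2 * (θ ^ 2 * R ^ 2)) := by
      calc _ ≤ ∑ _k : Fin n, τ / 2 * (θ ^ 2 * R ^ 2) := by
            refine Finset.sum_le_sum fun k _ => ?_
            rw [norm_smul, mul_pow, Real.norm_eq_abs, sq_abs]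
            gcongr
            exact hR k ω
        _ = _ := by simp
    simp only [inner_smul_right] at *
    rw [Finset.sum_sub_distrib, ← Finset.mul_sum]
    linarith
  · exact Finset.measurable_fun_sum _ fun k _ =>
      ((hB k).inner (hhm k)).sub (((hhm k).norm.pow_const 2).const_mul _)

end Martingale

/-! ### Squared norms of partial sums -/

section PartialSum

variable {H : Type*} [NormedAddCommGroup H]

/-- The sum of the terms with index less than `m`. -/
def partialSum {n : ℕ} (z : Fin n → H) (m : ℕ) : H :=
  ∑ j ∈ Finset.univ.filter (fun j : Fin n => j.val < m), z j

lemma filter_lt_succ {n m : ℕ} (h : m < n) :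
    Finset.univ.filter (fun k : Fin n => k.val < m + 1) =
      insert ⟨m, h⟩ (Finset.univ.filter (fun k : Fin n => k.val < m)) := by
  ext k; simp [Fin.ext_iff]; omega

lemma filter_lt_self (n : ℕ) :
    Finset.univ.filter (fun k : Fin n => k.val < n) = Finset.univ := by
  ext k; simp

lemma partialSum_self {n : ℕ} (z : Fin n → H) : partialSum z n = ∑ j, z j := by
  rw [partialSum, filter_lt_self]

variable [InnerProductSpace ℝ H]

/-- Telescoping of $\|N+z\|^2=\|N\|^2+\|z\|^2+2\langle z,N\rangle$. For independent centered terms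
this separates a diagonal part from a martingale. -/
lemma norm_partialSum_sq {n : ℕ} (z : Fin n → H) {m : ℕ} (hm : m ≤ n) :
    ‖partialSum z m‖ ^ 2 = ∑ j ∈ Finset.univ.filter (fun j : Fin n => j.val < m),
      (‖z j‖ ^ 2 + 2 * ⟪z j, partialSum z j.val⟫) := by
  induction m with
  | zero => simp [partialSum]
  | succ m ih =>
    have h : m < n := hm
    rw [filter_lt_succ h, Finset.sum_insert (by simp), ← ih h.le, partialSum, filter_lt_succ h,
      Finset.sum_insert (by simp), norm_add_sq_real]
    simp only [partialSum]

/-- The partial sums stay bounded if the stopped martingale part of their squared norm does. -/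
lemma norm_partialSum_le_of_stopped {Ω : Type*} {n : ℕ} (y : Fin n → Ω → H) {ω : Ω}
    {R V W : ℝ} (hR : 0 ≤ R) (hV : ∑ k, ‖y k ω‖ ^ 2 ≤ V)
    (hW : ∑ k, ⟪y k ω, stopped (fun k ω => partialSum (fun j => y j ω) k.val) R k ω⟫ ≤ W)
    (hVW : V + 2 * W ≤ R ^ 2) (k : Fin n) : ‖partialSum (fun j => y j ω) k.val‖ ≤ R := by
  by_contra hk
  set N : ℕ → H := partialSum fun j => y j ω with hN
  have hex : ∃ m, m < n ∧ R < ‖N m‖ := ⟨k, k.2, not_le.1 hk⟩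
  classical
  -- At the first passage `m` above `R`, the stopped sum over all indices equals the sum up to `m`.
  -- The bound `W` on the full stopped sum thus controls $\|N_m\|$ itself, and no maximal inequality
  -- is required.
  set m := Nat.find hex with hm
  obtain ⟨hmn, hmR⟩ : m < n ∧ R < ‖N m‖ := Nat.find_spec hex
  have hlt : ∀ j, j < m → ‖N j‖ ≤ R := fun j hj => by
    have := Nat.find_min hex hj
    push Not at this
    exact this (hj.trans hmn)
  have h1 : ∑ k, ⟪y k ω, stopped (fun k ω => partialSum (fun j => y j ω) k.val) R k ω⟫ =
      ∑ j ∈ Finset.univ.filter (fun j : Fin n => j.val < m), ⟪y j ω, N j.val⟫ := by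
    rw [Finset.sum_filter]
    refine Finset.sum_congr rfl fun j _ => ?_
    split_ifs with hj
    · rw [stopped_of_forall]
      exact fun i hi => hlt i (lt_of_le_of_lt hi hj)
    · unfold stopped
      rw [if_neg, inner_zero_right]
      intro hall
      exact absurd (hall ⟨m, hmn⟩ (not_lt.1 hj)) (not_le.2 hmR)
  have h2 := norm_partialSum_sq (fun j => y j ω) hmn.le
  rw [Finset.sum_add_distrib, ← Finset.mul_sum, ← h1] at h2
  have h3 : ∑ j ∈ Finset.univ.filter (fun j : Fin n => j.val < m), ‖y j ω‖ ^ 2 ≤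
      ∑ k, ‖y k ω‖ ^ 2 :=
    Finset.sum_le_sum_of_subset_of_nonneg (Finset.filter_subset _ _) fun _ _ _ => sq_nonneg _
  have h4 : R ^ 2 < ‖N m‖ ^ 2 := pow_lt_pow_left₀ hmR hR two_ne_zero
  rw [hN] at h4
  linarith

end PartialSum

/-! ### Concentration of the squared norm of a sum -/

section Concentration

variable {Ω : Type*} [mΩ : MeasurableSpace Ω] {P : Measure Ω}
  {H : Type*} [NormedAddCommGroup H] [InnerProductSpace ℝ H] [MeasurableSpace H] [BorelSpace H]
  [SecondCountableTopology H] {τ ρ : ℝ}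

omit mΩ in
lemma measurable_partialSum_past {n : ℕ} (B : Fin n → Ω → H) (T : H →L[ℝ] H) (k : Fin n) :
    Measurable[past B k.val] fun ω => partialSum (fun j => T (B j ω)) k.val :=
  Finset.measurable_fun_sum _ fun j hj =>
    T.measurable.comp (measurable_past B (by simpa using hj))

/-- Concentration of the squared norm of a normalized sum of independent vectors `S (B k)`, where
the `B k` are sub-gaussian near the origin. -/
theorem measure_sq_norm_sum_sub_le [IsProbabilityMeasure P] {n : ℕ} (hn : 0 < n)
    {B : Fin n → Ω → H} (hB : ∀ k, Measurable (B k)) (hind : iIndepFun B P)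
    (hsub : ∀ k, LocallySubgaussian (B k) P τ ρ) (hτ : 0 < τ) (hρ : 0 < ρ) (S : H →L[ℝ] H)
    (hS : ∀ x y, ⟪S x, y⟫ = ⟪x, S y⟫) (hS1 : ∀ x, ‖S x‖ ≤ ‖x‖) {m q l : ℝ} (hq : 0 ≤ q)
    (hl : 1 ≤ l) (h2i : ∀ k, Integrable (fun ω => ‖S (B k ω)‖ ^ 2) P)
    (h4i : ∀ k, Integrable (fun ω => (‖S (B k ω)‖ ^ 2) ^ 2) P)
    (hm : ∀ k, ∫ ω, ‖S (B k ω)‖ ^ 2 ∂P = m) (h4 : ∀ k, ∫ ω, (‖S (B k ω)‖ ^ 2) ^ 2 ∂P ≤ n)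
    (hY : ∀ k, ∫ ω, ‖S (S (B k ω))‖ ^ 2 ∂P ≤ τ * q ^ 2)
    (hbig : ∀ k, P {ω | (n : ℝ) < ‖S (B k ω)‖ ^ 2} ≤ ENNReal.ofReal (Real.exp (-l) / n))
    (hn1 : (10 * τ + 5) * (q ^ 2 + l) ≤ 4 * τ ^ 2 * ρ ^ 2 * n)
    (hn2 : (10 * τ + 5) * (q ^ 2 + l) ≤ ρ ^ 2 * n) :
    P {ω | (4 + 2 * τ * (10 * τ + 5)) * max (q * √l) l <
        |‖∑ k, S (B k ω)‖ ^ 2 / n - m|} ≤ 7 * ENNReal.ofReal (Real.exp (-l)) := by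
  have hn' : (0 : ℝ) < n := by exact_mod_cast hn
  -- This value lets half of $K^2$ absorb $\tau q^2+l+1+4\tau l$ in the bootstrap, using $l\ge1$.
  set κ := 10 * τ + 5 with hκ
  have hκ0 : 0 < κ := by positivity
  set K := √(κ * (q ^ 2 + l)) with hK
  have hK0 : 0 ≤ K := Real.sqrt_nonneg _
  have hK2 : K ^ 2 = κ * (q ^ 2 + l) := Real.sq_sqrt (by positivity)
  set R := K * √n with hR
  have hR0 : 0 ≤ R := by positivity
  have hR2 : R ^ 2 = K ^ 2 * n := by rw [hR, mul_pow, Real.sq_sqrt hn'.le]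
  have hKn2 : K ≤ ρ * √n := by
    refine abs_le_of_sq_le_sq' ?_ (by positivity) |>.2
    rw [mul_pow, Real.sq_sqrt hn'.le, hK2]; exact hn2
  have hKn1 : K ≤ 2 * τ * ρ * √n := by
    refine abs_le_of_sq_le_sq' ?_ (by positivity) |>.2
    rw [mul_pow, Real.sq_sqrt hn'.le, hK2]; linarith
  set M := max (q * √l) l with hM
  have hMl : l ≤ M := le_max_right _ _
  have hMq : q * √l ≤ M := le_max_left _ _
  have hl0 : 0 < l := by linarith
  have hM0 : 0 < M := by linarith
  have hlq : l * q ^ 2 ≤ M ^ 2 := by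
    have := pow_le_pow_left₀ (by positivity) hMq 2
    rwa [mul_pow, Real.sq_sqrt hl0.le, mul_comm] at this
  have hll : l * l ≤ M ^ 2 := by nlinarith
  have hsqrt : √(n : ℝ) * √n = n := Real.mul_self_sqrt hn'.le
  -- The exponent for the final transform is $t/n$: then $l/t=M$, while $t\le1$ keeps the
  -- coefficients within the sub-gaussian radius and $tK^2\le2\kappa M$ controls the quadratic term.
  set t := l / M with ht
  have ht0 : 0 < t := by positivity
  have ht1 : t ≤ 1 := (div_le_one hM0).2 hMl
  have htK : t * K ^ 2 ≤ 2 * κ * M := by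
    rw [ht, hK2, div_mul_eq_mul_div, div_le_iff₀ hM0]
    nlinarith
  -- the processes
  set Y : Fin n → Ω → H := fun k ω => S (S (B k ω)) with hYdef
  set N : Fin n → Ω → H := fun k ω => partialSum (fun j => Y j ω) k.val with hN
  have hNm : ∀ k, Measurable[past B k.val] (N k) := fun k =>
    measurable_partialSum_past B (S.comp S) k
  have hstm : ∀ k, Measurable[past B k.val] (stopped N R k) := measurable_stopped hNm R
  have hstR : ∀ k ω, ‖stopped N R k ω‖ ≤ R := norm_stopped_le N hR0
  -- the exceptional events
  have e1 : P {ω | ∃ k, (n : ℝ) < ‖S (B k ω)‖ ^ 2} ≤ ENNReal.ofReal (Real.exp (-l)) := by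
    have : {ω | ∃ k, (n : ℝ) < ‖S (B k ω)‖ ^ 2} = ⋃ k, {ω | (n : ℝ) < ‖S (B k ω)‖ ^ 2} := by
      ext; simp
    rw [this]
    refine (measure_iUnion_fintype_le P _).trans ((Finset.sum_le_sum fun k _ => hbig k).trans ?_)
    rw [Finset.sum_const, Finset.card_univ, Fintype.card_fin, nsmul_eq_mul,
      ENNReal.ofReal_div_of_pos hn', ENNReal.ofReal_natCast]
    exact ENNReal.mul_div_le
  have hZm : ∀ k, Measurable fun ω => ‖S (B k ω)‖ ^ 2 := fun k =>
    ((S.measurable.comp (hB k)).norm).pow_const 2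
  have hYm : ∀ k, Measurable fun ω => ‖Y k ω‖ ^ 2 := fun k =>
    ((S.measurable.comp (S.measurable.comp (hB k))).norm).pow_const 2
  have hZind : iIndepFun (fun k ω => ‖S (B k ω)‖ ^ 2) P :=
    hind.comp (fun _ b => ‖S b‖ ^ 2) fun _ => (S.measurable.norm).pow_const 2
  have hYind : iIndepFun (fun k ω => ‖Y k ω‖ ^ 2) P :=
    hind.comp (fun _ b => ‖S (S b)‖ ^ 2) fun _ =>
      ((S.measurable.comp S.measurable).norm).pow_const 2
  have hYZ : ∀ k ω, ‖Y k ω‖ ^ 2 ≤ ‖S (B k ω)‖ ^ 2 := fun k ω =>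
    pow_le_pow_left₀ (norm_nonneg _) (hS1 _) 2
  have hY2i : ∀ k, Integrable (fun ω => ‖Y k ω‖ ^ 2) P := fun k =>
    (h2i k).mono' (hYm k).aestronglyMeasurable (ae_of_all _ fun ω => by
      rw [Real.norm_eq_abs, abs_of_nonneg (by positivity)]; exact hYZ k ω)
  have hYZ2 : ∀ k ω, (‖Y k ω‖ ^ 2) ^ 2 ≤ (‖S (B k ω)‖ ^ 2) ^ 2 := fun k ω =>
    pow_le_pow_left₀ (by positivity) (hYZ k ω) 2
  have hY4i : ∀ k, Integrable (fun ω => (‖Y k ω‖ ^ 2) ^ 2) P := fun k =>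
    (h4i k).mono' ((hYm k).pow_const 2).aestronglyMeasurable (ae_of_all _ fun ω => by
      rw [Real.norm_eq_abs, abs_of_nonneg (by positivity)]; exact hYZ2 k ω)
  have e2 := measure_sum_gt_le_of_nonneg hZm hZind (fun k ω => by positivity) h2i h4i
    (fun k => (hm k).le) h4 l
  have e3 := measure_sum_lt_le_of_nonneg hZm hZind (fun k ω => by positivity) h2i h4i hm h4 l
  have e4 := measure_sum_gt_le_of_nonneg hYm hYind (fun k ω => by positivity) hY2i hY4i hY
    (fun k => (integral_mono (hY4i k) (h4i k) (hYZ2 k)).trans (h4 k)) l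
  -- With this $\theta$ the quadratic correction, after division by $\theta$, is $nK^2/4=R^2/4$.
  -- Doubled in the expansion of the squared norm it uses half of $R^2$, so the bootstrap closes.
  have e5 := measure_sum_inner_gt_le hB hind hsub hτ.le (R := R) (θ := 1 / (2 * τ * n))
    (h := fun k ω => S (S (stopped N R k ω)))
    (fun k => (S.measurable.comp S.measurable).comp (hstm k))
    (fun k ω => ((hS1 _).trans (hS1 _)).trans (hstR k ω)) (by
      rw [abs_of_pos (by positivity), div_mul_eq_mul_div, one_mul, div_le_iff₀ (by positivity), hR]
      calc K * √n ≤ (2 * τ * ρ * √n) * √n := by gcongr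
        _ = ρ * (2 * τ * n) := by rw [mul_assoc, hsqrt]; ring) l
  have hθ2 : |t / n| * R ≤ ρ := by
    rw [abs_of_pos (by positivity), hR, div_mul_eq_mul_div, div_le_iff₀ hn']
    calc t * (K * √n) ≤ 1 * ((ρ * √n) * √n) := by gcongr
      _ = ρ * n := by rw [mul_assoc, hsqrt]; ring
  have e6 := measure_sum_inner_gt_le hB hind hsub hτ.le hstm hstR hθ2 l
  have e7 := measure_sum_inner_gt_le hB hind hsub hτ.le (θ := -(t / n)) hstm hstR
    (by rwa [abs_neg]) l
  set ε := ENNReal.ofReal (Real.exp (-l)) with hε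
  refine le_trans (measure_mono ?_) (calc
    P ({ω | ∃ k, (n : ℝ) < ‖S (B k ω)‖ ^ 2} ∪ (_ ∪ (_ ∪ (_ ∪ (_ ∪ (_ ∪ _)))))) ≤
      ε + (ε + (ε + (ε + (ε + (ε + ε))))) :=
        (measure_union_le _ _).trans <| add_le_add e1 <| (measure_union_le _ _).trans <|
        add_le_add e2 <| (measure_union_le _ _).trans <| add_le_add e3 <|
        (measure_union_le _ _).trans <| add_le_add e4 <| (measure_union_le _ _).trans <|
        add_le_add e5 <| (measure_union_le _ _).trans <| add_le_add e6 e7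
    _ = 7 * ε := by ring)
  intro ω hω
  by_contra hcon
  simp only [Set.mem_union, Set.mem_ofPred_eq, not_or, not_exists, not_and, not_lt] at hω hcon
  obtain ⟨c1, c2, c3, c4, c5, c6, c7⟩ := hcon
  have c2 := c2 c1
  have c4 := c4 fun k => (hYZ k ω).trans (c1 k)
  -- Self-adjointness moves both copies of `S` onto the coefficient, leaving the sub-gaussian vector
  -- `B k` in the product.
  have c5' : ∑ k, ⟪Y k ω, stopped N R k ω⟫ ≤ n * (2 * τ * l + K ^ 2 / 4) := by
    have : ∑ k, ⟪Y k ω, stopped N R k ω⟫ = ∑ k, ⟪B k ω, S (S (stopped N R k ω))⟫ :=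
      Finset.sum_congr rfl fun k _ => by simp only [hYdef, hS]
    rw [this]
    rw [div_mul_eq_mul_div, one_mul, div_le_iff₀ (by positivity), hR2] at c5
    refine c5.trans (le_of_eq ?_)
    field_simp
    ring
  -- Here the bootstrap closes, so the stopped process equals the true one on the good event.
  have hNR : ∀ k, ‖N k ω‖ ≤ R := by
    refine norm_partialSum_le_of_stopped Y hR0 c4 c5' ?_
    rw [hR2]
    have : τ * q ^ 2 + (l + 1) + 2 * (2 * τ * l + K ^ 2 / 4) ≤ K ^ 2 := by
      rw [hK2, hκ]
      linarith [mul_nonneg hτ.le (sq_nonneg q), mul_nonneg hτ.le hl0.le, sq_nonneg q]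
    linarith [mul_le_mul_of_nonneg_left this hn'.le]
  have hst : ∀ k, stopped N R k ω = N k ω := fun k => stopped_of_forall fun j _ => hNR j
  simp only [hst] at c6 c7
  set W := ∑ k, ⟪B k ω, N k ω⟫ with hW
  have hnW : ‖∑ k, S (B k ω)‖ ^ 2 = ∑ k, ‖S (B k ω)‖ ^ 2 + 2 * W := by
    have := norm_partialSum_sq (fun j => S (B j ω)) le_rfl
    rw [partialSum_self, filter_lt_self, Finset.sum_add_distrib, ← Finset.mul_sum] at this
    rw [this, hW]
    congr 2
    refine Finset.sum_congr rfl fun k _ => ?_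
    rw [hS]
    simp only [hN, hYdef, partialSum, map_sum]
  have hbound : l + n * (τ / 2 * ((t / n) ^ 2 * R ^ 2)) ≤ t * (M + τ * κ * M) := by
    have h1 : l = t * M := by rw [ht]; field_simp
    have h2 : n * (τ / 2 * ((t / n) ^ 2 * R ^ 2)) = t * (τ / 2 * (t * K ^ 2)) := by
      rw [hR2]; field_simp
    have h3 : τ / 2 * (t * K ^ 2) ≤ τ * κ * M :=
      (mul_le_mul_of_nonneg_left htK (by positivity)).trans (le_of_eq (by ring))
    rw [h2, mul_add, ← h1]
    gcongr
  have w1 : W / n ≤ M + τ * κ * M := by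
    have : t * (W / n) ≤ t * (M + τ * κ * M) := by
      calc t * (W / n) = t / n * W := by ring
        _ ≤ _ := c6.trans hbound
    exact le_of_mul_le_mul_left this ht0
  have w2 : -(W / n) ≤ M + τ * κ * M := by
    have : t * (-(W / n)) ≤ t * (M + τ * κ * M) := by
      calc t * (-(W / n)) = -(t / n) * W := by ring
        _ ≤ _ := c7.trans (by rw [neg_sq]; exact hbound)
    exact le_of_mul_le_mul_left this ht0
  have d1 : (∑ k, ‖S (B k ω)‖ ^ 2) / n ≤ m + (l + 1) := by
    rw [div_le_iff₀ hn']; linarith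
  have d2 : m - (l + 1) ≤ (∑ k, ‖S (B k ω)‖ ^ 2) / n := by
    rw [le_div_iff₀ hn']; linarith
  refine absurd hω (not_lt.2 ?_)
  have hsplit : ‖∑ k, S (B k ω)‖ ^ 2 / n = (∑ k, ‖S (B k ω)‖ ^ 2) / n + 2 * (W / n) := by
    rw [hnW]; ring
  have hC : (4 + 2 * τ * κ) * M = 4 * M + 2 * (τ * κ * M) := by ring
  rw [hsplit, hC, abs_le]
  constructor <;> linarith

end Concentration

/-! ### Matrices as a Euclidean space, and conjugation by a symmetric matrix -/

section Frobenius

variable {d : ℕ}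

lemma frobNorm_sq (A : Matrix (Fin d) (Fin d) ℝ) : frobNorm A ^ 2 = ∑ i, ∑ j, A i j ^ 2 := by
  have : frobNorm A = √(∑ i, ∑ j, A i j ^ 2) := by
    rw [frobNorm, Matrix.frobenius_norm_def, Real.sqrt_eq_rpow]
    simp
  rw [this, Real.sq_sqrt (by positivity)]

lemma frobNorm_nonneg (A : Matrix (Fin d) (Fin d) ℝ) : 0 ≤ frobNorm A :=
  let := Matrix.frobeniusNormedAddCommGroup (m := Fin d) (n := Fin d) (α := ℝ)
  norm_nonneg A

lemma opNorm_nonneg (A : Matrix (Fin d) (Fin d) ℝ) : 0 ≤ opNorm A :=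
  let := Matrix.instL2OpNormedAddCommGroup (m := Fin d) (n := Fin d) (𝕜 := ℝ)
  norm_nonneg A

lemma frobNorm_smul (c : ℝ) (A : Matrix (Fin d) (Fin d) ℝ) :
    frobNorm (c • A) = |c| * frobNorm A := by
  rw [← sq_eq_sq₀ (frobNorm_nonneg _) (mul_nonneg (abs_nonneg _) (frobNorm_nonneg _)), mul_pow,
    sq_abs, frobNorm_sq, frobNorm_sq]
  simp [mul_pow, Finset.mul_sum]

lemma opNorm_smul (c : ℝ) (A : Matrix (Fin d) (Fin d) ℝ) : opNorm (c • A) = |c| * opNorm A := by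
  let := Matrix.instL2OpNormedAddCommGroup (m := Fin d) (n := Fin d) (𝕜 := ℝ)
  let := Matrix.instL2OpNormedSpace (m := Fin d) (n := Fin d) (𝕜 := ℝ)
  exact norm_smul c A

lemma frobNorm_transpose (A : Matrix (Fin d) (Fin d) ℝ) : frobNorm Aᵀ = frobNorm A :=
  Matrix.frobenius_norm_transpose A

lemma opNorm_sq_of_isSymm {A : Matrix (Fin d) (Fin d) ℝ} (hA : Aᵀ = A) :
    opNorm (A ^ 2) = opNorm A ^ 2 := by
  have := Matrix.l2_opNorm_conjTranspose_mul_self A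
  rw [Matrix.conjTranspose_eq_transpose_of_trivial, hA] at this
  rw [sq, sq]
  exact this

lemma sum_mulVec_sq_le (A : Matrix (Fin d) (Fin d) ℝ) (v : Fin d → ℝ) :
    ∑ i, (A *ᵥ v) i ^ 2 ≤ opNorm A ^ 2 * ∑ i, v i ^ 2 := by
  have h := Matrix.l2_opNorm_mulVec A (WithLp.toLp 2 v)
  have h2 := pow_le_pow_left₀ (norm_nonneg _) h 2
  rw [mul_pow, EuclideanSpace.norm_sq_eq, EuclideanSpace.norm_sq_eq] at h2
  simp only [Real.norm_eq_abs, sq_abs] at h2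
  exact h2

lemma frobNorm_mul_le_left (A V : Matrix (Fin d) (Fin d) ℝ) :
    frobNorm (A * V) ≤ opNorm A * frobNorm V := by
  refine abs_le_of_sq_le_sq' ?_ (mul_nonneg (opNorm_nonneg _) (frobNorm_nonneg _)) |>.2
  rw [mul_pow, frobNorm_sq, frobNorm_sq, Finset.sum_comm,
    Finset.sum_comm (f := fun i j => V i j ^ 2),
    Finset.mul_sum]
  refine Finset.sum_le_sum fun j _ => ?_
  exact sum_mulVec_sq_le A fun i => V i j

lemma frobNorm_mul_le_right {A : Matrix (Fin d) (Fin d) ℝ} (hA : Aᵀ = A)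
    (V : Matrix (Fin d) (Fin d) ℝ) : frobNorm (V * A) ≤ opNorm A * frobNorm V := by
  rw [← frobNorm_transpose, Matrix.transpose_mul, hA, ← frobNorm_transpose V]
  exact frobNorm_mul_le_left A Vᵀ

lemma trace_sq_eq_frobNorm_sq {A : Matrix (Fin d) (Fin d) ℝ} (hA : Aᵀ = A) :
    (A ^ 2).trace = frobNorm A ^ 2 := by
  rw [frobNorm_sq, sq, Matrix.trace]
  refine Finset.sum_congr rfl fun i _ => ?_
  rw [Matrix.diag_apply, Matrix.mul_apply]
  refine Finset.sum_congr rfl fun j _ => ?_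
  nth_rw 2 [← hA]
  rw [Matrix.transpose_apply, sq]

lemma frobNorm_vecMulVec (u v : Fin d → ℝ) :
    frobNorm (Matrix.vecMulVec u v) ^ 2 = (∑ i, u i ^ 2) * ∑ j, v j ^ 2 := by
  rw [frobNorm_sq, Finset.sum_mul_sum]
  simp [Matrix.vecMulVec_apply, mul_pow]

/-- A square matrix as a vector of the Euclidean space of its entries. -/
noncomputable def vec (A : Matrix (Fin d) (Fin d) ℝ) : EuclideanSpace ℝ (Fin d × Fin d) :=
  WithLp.toLp 2 fun p => A p.1 p.2

/-- The square matrix with given entries. -/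
def unvec (v : EuclideanSpace ℝ (Fin d × Fin d)) : Matrix (Fin d) (Fin d) ℝ :=
  Matrix.of fun i j => v (i, j)

@[simp] lemma vec_apply (A : Matrix (Fin d) (Fin d) ℝ) (p : Fin d × Fin d) :
    vec A p = A p.1 p.2 := rfl

@[simp] lemma unvec_vec (A : Matrix (Fin d) (Fin d) ℝ) : unvec (vec A) = A := rfl

@[simp] lemma vec_unvec (v : EuclideanSpace ℝ (Fin d × Fin d)) : vec (unvec v) = v := rfl

lemma norm_vec (A : Matrix (Fin d) (Fin d) ℝ) : ‖vec A‖ = frobNorm A := by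
  rw [← sq_eq_sq₀ (norm_nonneg _) (frobNorm_nonneg _), EuclideanSpace.norm_sq_eq, frobNorm_sq,
    Fintype.sum_prod_type]
  simp

lemma inner_vec (A B : Matrix (Fin d) (Fin d) ℝ) : ⟪vec A, vec B⟫ = (Aᵀ * B).trace := by
  rw [PiLp.inner_apply, Fintype.sum_prod_type, Matrix.trace, Finset.sum_comm]
  simp [Matrix.mul_apply, mul_comm]

/-- The map `V ↦ Q V Q` on the space of square matrices. -/
noncomputable def conjMap (Q : Matrix (Fin d) (Fin d) ℝ) :
    EuclideanSpace ℝ (Fin d × Fin d) →L[ℝ] EuclideanSpace ℝ (Fin d × Fin d) :=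
  LinearMap.toContinuousLinearMap
    { toFun := fun v => vec (Q * unvec v * Q)
      map_add' := fun v w => by
        have : unvec (v + w) = unvec v + unvec w := rfl
        rw [this, mul_add, add_mul]; rfl
      map_smul' := fun c v => by
        have : unvec (c • v) = c • unvec v := rfl
        rw [this, Matrix.mul_smul, Matrix.smul_mul]; rfl }

lemma conjMap_vec (Q V : Matrix (Fin d) (Fin d) ℝ) : conjMap Q (vec V) = vec (Q * V * Q) := rfl

lemma inner_conjMap {Q : Matrix (Fin d) (Fin d) ℝ} (hQ : Qᵀ = Q)
    (x y : EuclideanSpace ℝ (Fin d × Fin d)) : ⟪conjMap Q x, y⟫ = ⟪x, conjMap Q y⟫ := by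
  rw [← vec_unvec x, ← vec_unvec y, conjMap_vec, conjMap_vec, inner_vec, inner_vec,
    Matrix.transpose_mul, Matrix.transpose_mul, hQ, Matrix.mul_assoc Q, Matrix.trace_mul_comm]
  simp only [Matrix.mul_assoc]

lemma norm_conjMap_le {Q : Matrix (Fin d) (Fin d) ℝ} (hQ : Qᵀ = Q) (hQ1 : opNorm Q ≤ 1)
    (x : EuclideanSpace ℝ (Fin d × Fin d)) : ‖conjMap Q x‖ ≤ ‖x‖ := by
  rw [← vec_unvec x, conjMap_vec, norm_vec, norm_vec]
  have h1 := frobNorm_mul_le_right hQ (Q * unvec x)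
  have h2 := frobNorm_mul_le_left Q (unvec x)
  nlinarith [frobNorm_nonneg (Q * unvec x), frobNorm_nonneg (unvec x), opNorm_nonneg Q]

lemma trace_mul_self_eq {Q : Matrix (Fin d) (Fin d) ℝ} (hQ : Qᵀ = Q) :
    (Q * Q).trace = frobNorm Q ^ 2 := by
  rw [← sq, trace_sq_eq_frobNorm_sq hQ]

lemma transpose_mul_self {Q : Matrix (Fin d) (Fin d) ℝ} (hQ : Qᵀ = Q) : (Q * Q)ᵀ = Q * Q := by
  rw [Matrix.transpose_mul, hQ]

lemma frobNorm_mul_self_le (Q : Matrix (Fin d) (Fin d) ℝ) : frobNorm (Q * Q) ≤ frobNorm Q ^ 2 := by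
  rw [sq]
  exact Matrix.frobenius_norm_mul Q Q

lemma quadForm_smul (c : ℝ) (U : Matrix (Fin d) (Fin d) ℝ) (x : Fin d → ℝ) :
    quadForm (c • U) x = c * quadForm U x := by
  simp [quadForm, Matrix.smul_mulVec]

lemma quadForm_eq_sum (U : Matrix (Fin d) (Fin d) ℝ) (x : Fin d → ℝ) :
    quadForm U x = ∑ i, ∑ j, U i j * (x i * x j) := by
  simp only [quadForm, dotProduct, Matrix.mulVec, Finset.mul_sum]
  refine Finset.sum_congr rfl fun i _ => Finset.sum_congr rfl fun j _ => by ring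

@[fun_prop]
lemma measurable_quadForm (U : Matrix (Fin d) (Fin d) ℝ) : Measurable (quadForm U) := by
  have : quadForm U = fun x => ∑ i, ∑ j, U i j * (x i * x j) := funext (quadForm_eq_sum U)
  rw [this]; fun_prop

lemma quadForm_mul_self {Q : Matrix (Fin d) (Fin d) ℝ} (hQ : Qᵀ = Q) (x : Fin d → ℝ) :
    quadForm (Q * Q) x = ∑ i, (Q *ᵥ x) i ^ 2 := by
  rw [quadForm, ← Matrix.mulVec_mulVec, Matrix.dotProduct_mulVec, ← Matrix.mulVec_transpose, hQ,
    dotProduct]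
  simp [sq]

/-- The centered quadratic form of a whitened vector. -/
noncomputable def centeredQuad (U : Matrix (Fin d) (Fin d) ℝ) (x : Fin d → ℝ) : ℝ :=
  quadForm U x - U.trace

@[fun_prop]
lemma measurable_centeredQuad (U : Matrix (Fin d) (Fin d) ℝ) : Measurable (centeredQuad U) :=
  (measurable_quadForm U).sub_const _

lemma centeredQuad_smul (c : ℝ) (U : Matrix (Fin d) (Fin d) ℝ) (x : Fin d → ℝ) :
    centeredQuad (c • U) x = c * centeredQuad U x := by
  simp [centeredQuad, quadForm_smul, mul_sub]

/-- The centered square `x xᵀ - 1`, as a vector. -/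
noncomputable def centeredSq (x : Fin d → ℝ) : EuclideanSpace ℝ (Fin d × Fin d) :=
  vec (Matrix.vecMulVec x x - 1)

lemma measurable_centeredSq : Measurable (centeredSq (d := d)) := by
  refine (WithLp.measurable_toLp 2 _).comp ?_
  refine measurable_pi_lambda _ fun p => ?_
  simp only [Matrix.sub_apply, Matrix.vecMulVec_apply]
  fun_prop

lemma inner_centeredSq (x : Fin d → ℝ) (v : EuclideanSpace ℝ (Fin d × Fin d)) :
    ⟪centeredSq x, v⟫ = centeredQuad (unvec v) x := by
  rw [← vec_unvec v, centeredSq, inner_vec, unvec_vec, Matrix.transpose_sub, sub_mul,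
    Matrix.trace_sub, Matrix.transpose_one, one_mul, Matrix.transpose_vecMulVec,
    Matrix.vecMulVec_mul, Matrix.trace_vecMulVec, centeredQuad, quadForm, Matrix.dotProduct_mulVec,
    dotProduct_comm]

lemma conjMap_centeredSq {Q : Matrix (Fin d) (Fin d) ℝ} (hQ : Qᵀ = Q) (x : Fin d → ℝ) :
    conjMap Q (centeredSq x) = vec (Matrix.vecMulVec (Q *ᵥ x) (Q *ᵥ x) - Q * Q) := by
  rw [centeredSq, conjMap_vec, Matrix.mul_sub, Matrix.sub_mul, Matrix.mul_one,
    Matrix.mul_vecMulVec, Matrix.vecMulVec_mul, ← Matrix.mulVec_transpose, hQ]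

/-- The rank-one part has norm $|Qx|^2$, and $\|Q^2\|_F\le\mathrm{Tr}\,Q^2$. Thus one scalar
quadratic form controls both the moments and the tail of the matrix norm. -/
lemma norm_conjMap_centeredSq_le {Q : Matrix (Fin d) (Fin d) ℝ} (hQ : Qᵀ = Q) (x : Fin d → ℝ) :
    ‖conjMap Q (centeredSq x)‖ ≤ centeredQuad (Q * Q) x + 2 * (Q * Q).trace := by
  have h1 : ‖vec (Matrix.vecMulVec (Q *ᵥ x) (Q *ᵥ x))‖ = quadForm (Q * Q) x := by
    rw [quadForm_mul_self hQ, norm_vec, ← sq_eq_sq₀ (frobNorm_nonneg _) (by positivity),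
      frobNorm_vecMulVec, sq]
  have h2 : ‖vec (Q * Q)‖ ≤ (Q * Q).trace := by
    rw [norm_vec, trace_mul_self_eq hQ]; exact frobNorm_mul_self_le Q
  have h3 : conjMap Q (centeredSq x) =
      vec (Matrix.vecMulVec (Q *ᵥ x) (Q *ᵥ x)) - vec (Q * Q) := conjMap_centeredSq hQ x
  rw [h3]
  refine (norm_sub_le _ _).trans ?_
  rw [h1, centeredQuad]
  linarith

end Frobenius

/-! ### Jensen's inequality for second and fourth moments -/

lemma sq_integral_le_integral_sq {α : Type*} [MeasurableSpace α] {ν : Measure α}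
    [IsProbabilityMeasure ν] {g : α → ℝ} (hg : Integrable g ν)
    (hg2 : Integrable (fun x => g x ^ 2) ν) : (∫ x, g x ∂ν) ^ 2 ≤ ∫ x, g x ^ 2 ∂ν := by
  set m := ∫ x, g x ∂ν
  have h0 : 0 ≤ ∫ x, (g x - m) ^ 2 ∂ν := integral_nonneg fun x => sq_nonneg _
  have h1 : ∫ x, (g x - m) ^ 2 ∂ν = ∫ x, (g x ^ 2 - (2 * m * g x - m ^ 2)) ∂ν :=
    integral_congr_ae (ae_of_all _ fun x => by ring)
  have hi : Integrable (fun x => 2 * m * g x - m ^ 2) ν :=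
    (hg.const_mul _).sub (integrable_const _)
  rw [h1, integral_sub hg2 hi, integral_sub (hg.const_mul _) (integrable_const _),
    integral_const_mul] at h0
  simp only [integral_const, probReal_univ, one_smul] at h0
  nlinarith

section Moments

variable {α : Type*} [MeasurableSpace α] {ν : Measure α} {f : α → ℝ}

lemma integrable_sq_of_integrable_pow_four [IsFiniteMeasure ν] (hf : AEStronglyMeasurable f ν)
    (h4 : Integrable (fun x => f x ^ 4) ν) : Integrable (fun x => f x ^ 2) ν := by
  refine ((integrable_const (1 : ℝ)).add h4).mono' (hf.pow 2) (ae_of_all _ fun x => ?_)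
  rw [Real.norm_eq_abs, abs_of_nonneg (sq_nonneg _)]
  change f x ^ 2 ≤ 1 + f x ^ 4
  nlinarith [sq_nonneg (f x ^ 2 - 1), sq_nonneg (f x)]

lemma integral_sq_le_of_integral_pow_four_le [IsProbabilityMeasure ν]
    (hf : AEStronglyMeasurable f ν) (h4 : Integrable (fun x => f x ^ 4) ν) {b : ℝ} (hb : 0 ≤ b)
    (h : ∫ x, f x ^ 4 ∂ν ≤ b ^ 2) : ∫ x, f x ^ 2 ∂ν ≤ b := by
  have h2 : ∀ x, (f x ^ 2) ^ 2 = f x ^ 4 := fun x => by ring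
  have := sq_integral_le_integral_sq (integrable_sq_of_integrable_pow_four hf h4)
    (by simpa only [h2] using h4)
  simp only [h2] at this
  exact abs_le_of_sq_le_sq' (this.trans h) hb |>.2

end Moments

/-! ### Moments and Laplace transform of the whitened vector -/

section Whitened

variable {d : ℕ} {ν : Measure (Fin d → ℝ)} {τ ρ : ℝ}

lemma tiltedLaw_zero [IsProbabilityMeasure ν] : tiltedLaw ν 0 = ν := by
  have : quadForm (0 : Matrix (Fin d) (Fin d) ℝ) = 0 := by
    funext x; simp [quadForm]
  rw [tiltedLaw, this, tilted_zero]

lemma frobNorm_zero : frobNorm (0 : Matrix (Fin d) (Fin d) ℝ) = 0 := by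
  have := frobNorm_smul 0 (0 : Matrix (Fin d) (Fin d) ℝ)
  simpa using this

lemma TiltedFourthMomentBound.integrable_quadForm [IsProbabilityMeasure ν]
    (h : TiltedFourthMomentBound ν τ ρ) (hρ : 0 ≤ ρ) (V : Matrix (Fin d) (Fin d) ℝ) :
    Integrable (quadForm V) ν := by
  have := ((h 0 (by rwa [frobNorm_zero])).2 V).1
  rwa [tiltedLaw_zero] at this

lemma IsCenteredLaw.integral_quadForm (hc : IsCenteredLaw ν 1) (V : Matrix (Fin d) (Fin d) ℝ) :
    ∫ x, quadForm V x ∂ν = V.trace := by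
  have hint : ∀ i j, Integrable (fun x : Fin d → ℝ => V i j * (x i * x j)) ν := fun i j =>
    ((hc.memLp i).integrable_mul (hc.memLp j)).const_mul _
  simp_rw [quadForm_eq_sum]
  rw [integral_finsetSum _ fun i _ => integrable_finsetSum _ fun j _ => hint i j, Matrix.trace]
  refine Finset.sum_congr rfl fun i _ => ?_
  rw [integral_finsetSum _ fun j _ => hint i j]
  simp_rw [integral_const_mul, hc.cov_eq, Matrix.one_apply]
  simp

lemma integral_centeredQuad (hc : IsCenteredLaw ν 1) (h : TiltedFourthMomentBound ν τ ρ)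
    (hρ : 0 ≤ ρ) (V : Matrix (Fin d) (Fin d) ℝ) : ∫ x, centeredQuad V x ∂ν = 0 := by
  have := hc.prob
  simp only [centeredQuad]
  rw [integral_sub (h.integrable_quadForm hρ V) (integrable_const _), hc.integral_quadForm]
  simp

lemma integrable_centeredQuad (hc : IsCenteredLaw ν 1) (h : TiltedFourthMomentBound ν τ ρ)
    (hρ : 0 ≤ ρ) (V : Matrix (Fin d) (Fin d) ℝ) : Integrable (centeredQuad V) ν := by
  have := hc.prob
  exact (h.integrable_quadForm hρ V).sub (integrable_const _)

lemma integrable_centeredQuad_pow_four (hc : IsCenteredLaw ν 1)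
    (h : TiltedFourthMomentBound ν τ ρ) (hρ : 0 ≤ ρ) (V : Matrix (Fin d) (Fin d) ℝ) :
    Integrable (fun x => centeredQuad V x ^ 4) ν := by
  have := hc.prob
  have := ((h 0 (by rwa [frobNorm_zero])).2 V).2.1
  rwa [tiltedLaw_zero, hc.integral_quadForm] at this

lemma integral_centeredQuad_pow_four_le (hc : IsCenteredLaw ν 1)
    (h : TiltedFourthMomentBound ν τ ρ) (hρ : 0 ≤ ρ) (V : Matrix (Fin d) (Fin d) ℝ) :
    ∫ x, centeredQuad V x ^ 4 ∂ν ≤ τ ^ 2 * frobNorm V ^ 4 := by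
  have := hc.prob
  have := ((h 0 (by rwa [frobNorm_zero])).2 V).2.2
  rwa [tiltedLaw_zero, hc.integral_quadForm] at this

lemma integrable_centeredQuad_sq (hc : IsCenteredLaw ν 1)
    (h : TiltedFourthMomentBound ν τ ρ) (hρ : 0 ≤ ρ) (V : Matrix (Fin d) (Fin d) ℝ) :
    Integrable (fun x => centeredQuad V x ^ 2) ν := by
  have := hc.prob
  exact integrable_sq_of_integrable_pow_four (measurable_centeredQuad V).aestronglyMeasurable
    (integrable_centeredQuad_pow_four hc h hρ V)

lemma integral_centeredQuad_sq_le (hc : IsCenteredLaw ν 1)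
    (h : TiltedFourthMomentBound ν τ ρ) (hτ : 0 ≤ τ) (hρ : 0 ≤ ρ)
    (V : Matrix (Fin d) (Fin d) ℝ) : ∫ x, centeredQuad V x ^ 2 ∂ν ≤ τ * frobNorm V ^ 2 := by
  have := hc.prob
  refine integral_sq_le_of_integral_pow_four_le (measurable_centeredQuad V).aestronglyMeasurable
    (integrable_centeredQuad_pow_four hc h hρ V) (by positivity) ?_
  exact (integral_centeredQuad_pow_four_le hc h hρ V).trans (le_of_eq (by ring))

/-- Centering changes the exponent by a constant, which the normalization of the tilt cancels. -/
lemma tilted_mul_centeredQuad [IsProbabilityMeasure ν] (h : TiltedFourthMomentBound ν τ ρ)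
    {U : Matrix (Fin d) (Fin d) ℝ} {t : ℝ} (ht : frobNorm (t • U) ≤ ρ) :
    ν.tilted (t * centeredQuad U ·) = tiltedLaw ν (t • U) := by
  have hi := (h _ ht).1
  have := isProbabilityMeasure_tilted hi
  have h1 : (fun x => t * centeredQuad U x) = quadForm (t • U) + fun _ => -(t * U.trace) := by
    funext x; simp [centeredQuad, quadForm_smul]; ring
  rw [h1, ← tilted_tilted hi, tilted_const, tiltedLaw]

lemma integrable_exp_mul_centeredQuad (h : TiltedFourthMomentBound ν τ ρ)
    {U : Matrix (Fin d) (Fin d) ℝ} {t : ℝ} (ht : frobNorm (t • U) ≤ ρ) :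
    Integrable (fun x => Real.exp (t * centeredQuad U x)) ν := by
  refine ((h _ ht).1.mul_const (Real.exp (-(t * U.trace)))).congr (ae_of_all _ fun x => ?_)
  simp only
  rw [← Real.exp_add, centeredQuad, quadForm_smul]
  ring_nf

lemma variance_tilted_centeredQuad_le [IsProbabilityMeasure ν]
    (h : TiltedFourthMomentBound ν τ ρ) (hτ : 0 ≤ τ)
    {U : Matrix (Fin d) (Fin d) ℝ} {t : ℝ} (ht : frobNorm (t • U) ≤ ρ) :
    Var[centeredQuad U; ν.tilted (t * centeredQuad U ·)] ≤ τ * frobNorm U ^ 2 := by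
  rw [tilted_mul_centeredQuad h ht]
  have hp : IsProbabilityMeasure (tiltedLaw ν (t • U)) := isProbabilityMeasure_tilted (h _ ht).1
  obtain ⟨hi, h4, hle⟩ := (h _ ht).2 U
  rw [variance_eq_integral (measurable_centeredQuad U).aemeasurable]
  have hmean : ∫ x, centeredQuad U x ∂tiltedLaw ν (t • U) =
      ∫ x, quadForm U x ∂tiltedLaw ν (t • U) - U.trace := by
    simp only [centeredQuad]
    rw [integral_sub hi (integrable_const _)]
    simp
  rw [hmean]
  simp only [centeredQuad, sub_sub_sub_cancel_right]
  refine integral_sq_le_of_integral_pow_four_le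
    ((measurable_quadForm U).sub_const _).aestronglyMeasurable h4 (by positivity) ?_
  exact hle.trans (le_of_eq (by ring))

/-- The log-Laplace transform of the centered square is dominated by a parabola. -/
lemma mgf_centeredQuad_le (hc : IsCenteredLaw ν 1) (h : TiltedFourthMomentBound ν τ ρ)
    (hτ : 0 ≤ τ) (hρ : 0 < ρ) {U : Matrix (Fin d) (Fin d) ℝ} (hU : frobNorm U ≤ ρ / 2) :
    mgf (centeredQuad U) ν 1 ≤ Real.exp (τ / 2 * frobNorm U ^ 2) := by
  have := hc.prob
  -- Halving the radius leaves room for a neighborhood of $[0,1]$ on which the Laplace transform is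
  -- finite, so that the cumulant generating function is smooth there.
  have hfr : ∀ t ∈ Set.Ioo (-2 : ℝ) 2, frobNorm (t • U) ≤ ρ := fun t ht => by
    rw [frobNorm_smul]
    have h2 : |t| ≤ 2 := abs_le.2 ⟨ht.1.le, ht.2.le⟩
    nlinarith [frobNorm_nonneg U, abs_nonneg t]
  have hsub : Set.Ioo (-2 : ℝ) 2 ⊆ interior (integrableExpSet (centeredQuad U) ν) :=
    interior_maximal (fun t ht => integrable_exp_mul_centeredQuad h (hfr t ht)) isOpen_Ioo
  have hs : Set.Icc (0 : ℝ) 1 ⊆ interior (integrableExpSet (centeredQuad U) ν) := fun t ht =>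
    hsub ⟨by linarith [ht.1], by linarith [ht.2]⟩
  -- Taylor's formula with Lagrange remainder: the cumulant generating function and its derivative
  -- vanish at $0$, so its value at $1$ is half of a tilted variance.
  obtain ⟨u, hu, hcgf⟩ := exists_cgf_eq_iteratedDeriv_two_cgf_mul one_pos
    (integral_centeredQuad hc h hρ.le U) hs
  have hu' : u ∈ Set.Ioo (-2 : ℝ) 2 := ⟨by linarith [hu.1], by linarith [hu.2]⟩
  rw [← exp_cgf (integrable_exp_mul_centeredQuad h (hfr 1 ⟨by norm_num, by norm_num⟩)), hcgf,
    ← variance_tilted_mul (hsub hu'), Real.exp_le_exp]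
  linarith [variance_tilted_centeredQuad_le h hτ (hfr u hu')]

lemma lintegral_exp_centeredQuad_le (hc : IsCenteredLaw ν 1) (h : TiltedFourthMomentBound ν τ ρ)
    (hτ : 0 ≤ τ) (hρ : 0 < ρ) {U : Matrix (Fin d) (Fin d) ℝ} (hU : frobNorm U ≤ ρ / 2) :
    ∫⁻ x, ENNReal.ofReal (Real.exp (centeredQuad U x - τ / 2 * frobNorm U ^ 2)) ∂ν ≤ 1 := by
  have hi := integrable_exp_mul_centeredQuad h (U := U) (t := 1) (by
    rw [one_smul]; linarith)
  simp only [one_mul] at hi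
  simp_rw [Real.exp_sub]
  rw [← ofReal_integral_eq_lintegral_ofReal (hi.div_const _) (ae_of_all _ fun _ => by positivity),
    ENNReal.ofReal_le_one, integral_div, div_le_one (Real.exp_pos _)]
  simpa [mgf] using mgf_centeredQuad_le hc h hτ hρ hU

lemma locallySubgaussian_centeredSq (hc : IsCenteredLaw ν 1)
    (h : TiltedFourthMomentBound ν τ ρ) (hτ : 0 ≤ τ) (hρ : 0 < ρ) :
    LocallySubgaussian centeredSq ν τ (ρ / 2) := by
  intro v hv
  rw [← vec_unvec v, norm_vec] at hv ⊢
  simp_rw [inner_centeredSq, unvec_vec]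
  exact lintegral_exp_centeredQuad_le hc h hτ hρ hv

variable {Q : Matrix (Fin d) (Fin d) ℝ}

lemma norm_conjMap_centeredSq_pow_four_le (hQ : Qᵀ = Q) (x : Fin d → ℝ) :
    (‖conjMap Q (centeredSq x)‖ ^ 2) ^ 2 ≤
      8 * centeredQuad (Q * Q) x ^ 4 + 128 * (Q * Q).trace ^ 4 := by
  set a := centeredQuad (Q * Q) x
  set r := (Q * Q).trace
  have h1 := pow_le_pow_left₀ (norm_nonneg _) (norm_conjMap_centeredSq_le hQ x) 4
  calc _ = ‖conjMap Q (centeredSq x)‖ ^ 4 := by ring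
    _ ≤ (a + 2 * r) ^ 4 := h1
    _ ≤ (2 * (a ^ 2 + (2 * r) ^ 2)) ^ 2 := by
        have : (a + 2 * r) ^ 2 ≤ 2 * (a ^ 2 + (2 * r) ^ 2) := add_sq_le
        calc _ = ((a + 2 * r) ^ 2) ^ 2 := by ring
          _ ≤ _ := pow_le_pow_left₀ (sq_nonneg _) this 2
    _ ≤ _ := by nlinarith [sq_nonneg (a ^ 2 - (2 * r) ^ 2)]

lemma measurable_norm_conjMap_centeredSq (Q : Matrix (Fin d) (Fin d) ℝ) :
    Measurable fun x => ‖conjMap Q (centeredSq x)‖ :=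
  ((conjMap Q).measurable.comp measurable_centeredSq).norm

lemma integrable_norm_conjMap_pow_four (hc : IsCenteredLaw ν 1)
    (h : TiltedFourthMomentBound ν τ ρ) (hρ : 0 ≤ ρ) (hQ : Qᵀ = Q) :
    Integrable (fun x => (‖conjMap Q (centeredSq x)‖ ^ 2) ^ 2) ν := by
  have := hc.prob
  refine (((integrable_centeredQuad_pow_four hc h hρ (Q * Q)).const_mul 8).add
    (integrable_const (128 * (Q * Q).trace ^ 4))).mono'
    (((measurable_norm_conjMap_centeredSq Q).pow_const 2).pow_const 2).aestronglyMeasurable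
    (ae_of_all _ fun x => ?_)
  rw [Real.norm_eq_abs, abs_of_nonneg (sq_nonneg _)]
  exact norm_conjMap_centeredSq_pow_four_le hQ x

lemma integrable_norm_conjMap_sq (hc : IsCenteredLaw ν 1)
    (h : TiltedFourthMomentBound ν τ ρ) (hρ : 0 ≤ ρ) (hQ : Qᵀ = Q) :
    Integrable (fun x => ‖conjMap Q (centeredSq x)‖ ^ 2) ν := by
  have := hc.prob
  refine integrable_sq_of_integrable_pow_four
    (measurable_norm_conjMap_centeredSq Q).aestronglyMeasurable ?_
  refine (integrable_norm_conjMap_pow_four hc h hρ hQ).congr (ae_of_all _ fun x => ?_)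
  simp only
  ring

lemma frobNorm_mul_self_le_trace (hQ : Qᵀ = Q) : frobNorm (Q * Q) ≤ (Q * Q).trace := by
  rw [trace_mul_self_eq hQ]
  exact frobNorm_mul_self_le Q

lemma integral_norm_conjMap_pow_four_le (hc : IsCenteredLaw ν 1)
    (h : TiltedFourthMomentBound ν τ ρ) (hρ : 0 ≤ ρ) (hQ : Qᵀ = Q) :
    ∫ x, (‖conjMap Q (centeredSq x)‖ ^ 2) ^ 2 ∂ν ≤
      (8 * τ ^ 2 + 128) * (Q * Q).trace ^ 4 := by
  have := hc.prob
  have hi := (integrable_centeredQuad_pow_four hc h hρ (Q * Q)).const_mul 8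
  refine (integral_mono (integrable_norm_conjMap_pow_four hc h hρ hQ)
    (hi.add (integrable_const (128 * (Q * Q).trace ^ 4)))
    fun x => norm_conjMap_centeredSq_pow_four_le hQ x).trans ?_
  simp only [Pi.add_apply]
  rw [integral_add hi (integrable_const _), integral_const_mul]
  simp only [integral_const, probReal_univ, one_smul]
  have h1 := integral_centeredQuad_pow_four_le hc h hρ (Q * Q)
  have h2 := pow_le_pow_left₀ (frobNorm_nonneg _) (frobNorm_mul_self_le_trace hQ) 4
  nlinarith [mul_le_mul_of_nonneg_left h2 (sq_nonneg τ)]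

/-- Each entry is a centered quadratic form with a rank-one matrix, so the scalar assumption applies
entry by entry. -/
lemma conjMap_centeredSq_apply (hQ : Qᵀ = Q) (x : Fin d → ℝ) (p : Fin d × Fin d) :
    conjMap Q (centeredSq x) p = centeredQuad (Matrix.vecMulVec (Q p.1) (Q p.2)) x := by
  rw [conjMap_centeredSq hQ, vec_apply, Matrix.sub_apply, Matrix.vecMulVec_apply, centeredQuad,
    quadForm, Matrix.vecMulVec_mulVec, Matrix.trace_vecMulVec, Matrix.mul_apply]
  have h2 : ∑ j, Q p.1 j * Q j p.2 = Q p.1 ⬝ᵥ Q p.2 := by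
    refine Finset.sum_congr rfl fun j _ => ?_
    nth_rw 2 [← hQ]
    rfl
  rw [h2]
  simp [Matrix.mulVec, dotProduct_comm, mul_comm]

/-- The entry $(i,j)$ contributes at most $\tau|q_i|^2|q_j|^2$, with $q_i$ the rows of $Q$, and the
double sum factorizes. -/
lemma integral_norm_conjMap_sq_le (hc : IsCenteredLaw ν 1)
    (h : TiltedFourthMomentBound ν τ ρ) (hτ : 0 ≤ τ) (hρ : 0 ≤ ρ) (hQ : Qᵀ = Q) :
    ∫ x, ‖conjMap Q (centeredSq x)‖ ^ 2 ∂ν ≤ τ * (frobNorm Q ^ 2) ^ 2 := by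
  simp_rw [EuclideanSpace.norm_sq_eq, Real.norm_eq_abs, sq_abs, conjMap_centeredSq_apply hQ]
  rw [integral_finsetSum _ fun p _ => integrable_centeredQuad_sq hc h hρ _]
  calc _ ≤ ∑ p : Fin d × Fin d, τ * ((∑ i, Q p.1 i ^ 2) * ∑ j, Q p.2 j ^ 2) :=
        Finset.sum_le_sum fun p _ => (integral_centeredQuad_sq_le hc h hτ hρ _).trans
          (le_of_eq (by rw [frobNorm_vecMulVec]))
    _ = _ := by
        rw [← Finset.mul_sum, frobNorm_sq, sq, Finset.sum_mul_sum, Fintype.sum_prod_type]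

/-- With $y=Q\xi$ and $A=Q^2$, $\|yy^\top-A\|_F^2=|y|^4-2y^\top Ay+\|A\|_F^2$. The middle
expectation is $\|A\|_F^2$, and $\mathbb E|y|^4\ge(\mathbb E|y|^2)^2=(\mathrm{Tr}\,A)^2$. -/
lemma le_integral_norm_conjMap_sq (hc : IsCenteredLaw ν 1)
    (h : TiltedFourthMomentBound ν τ ρ) (hρ : 0 ≤ ρ) (hQ : Qᵀ = Q) :
    (Q * Q).trace ^ 2 - frobNorm (Q * Q) ^ 2 ≤ ∫ x, ‖conjMap Q (centeredSq x)‖ ^ 2 ∂ν := by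
  have := hc.prob
  have hA : (Q * Q)ᵀ = Q * Q := transpose_mul_self hQ
  have hpt : ∀ x, ‖conjMap Q (centeredSq x)‖ ^ 2 =
      (centeredQuad (Q * Q) x + (Q * Q).trace) ^ 2 -
        (2 * quadForm (Q * Q * (Q * Q)) x - frobNorm (Q * Q) ^ 2) := by
    intro x
    have h1 : quadForm (Q * Q * (Q * Q)) x =
        ∑ i, ∑ j, (Q * Q) i j * ((Q *ᵥ x) i * (Q *ᵥ x) j) := by
      have hadj : ∀ w, Q *ᵥ x ⬝ᵥ w = x ⬝ᵥ Q *ᵥ w := fun w => by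
        rw [Matrix.dotProduct_mulVec, ← Matrix.mulVec_transpose, hQ]
      rw [← quadForm_eq_sum, quadForm, quadForm, hadj]
      simp only [Matrix.mulVec_mulVec, Matrix.mul_assoc]
    have h2 : centeredQuad (Q * Q) x + (Q * Q).trace = ∑ i, (Q *ᵥ x) i ^ 2 := by
      rw [centeredQuad, quadForm_mul_self hQ]; ring
    rw [h1, h2, conjMap_centeredSq hQ, norm_vec, frobNorm_sq, frobNorm_sq, sq (∑ i, _),
      Finset.sum_mul_sum, Finset.mul_sum, ← Finset.sum_sub_distrib, ← Finset.sum_sub_distrib]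
    refine Finset.sum_congr rfl fun i _ => ?_
    rw [Finset.mul_sum, ← Finset.sum_sub_distrib, ← Finset.sum_sub_distrib]
    refine Finset.sum_congr rfl fun j _ => ?_
    rw [Matrix.sub_apply, Matrix.vecMulVec_apply]
    ring
  set r := (Q * Q).trace with hr
  have i1 : Integrable (fun x => centeredQuad (Q * Q) x + r) ν :=
    (integrable_centeredQuad hc h hρ _).add (integrable_const _)
  have i2 : Integrable (fun x => (centeredQuad (Q * Q) x + r) ^ 2) ν := by
    refine (((integrable_centeredQuad_sq hc h hρ (Q * Q)).add
      ((integrable_centeredQuad hc h hρ (Q * Q)).const_mul (2 * r))).add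
      (integrable_const (r ^ 2))).congr (ae_of_all _ fun x => ?_)
    simp only [Pi.add_apply]
    ring
  have i3 : Integrable (fun x => 2 * quadForm (Q * Q * (Q * Q)) x) ν :=
    (h.integrable_quadForm hρ _).const_mul 2
  have hsq := sq_integral_le_integral_sq i1 i2
  rw [integral_add (integrable_centeredQuad hc h hρ _) (integrable_const _),
    integral_centeredQuad hc h hρ] at hsq
  simp_rw [hpt]
  have i4 : Integrable (fun x => 2 * quadForm (Q * Q * (Q * Q)) x - frobNorm (Q * Q) ^ 2) ν :=
    i3.sub (integrable_const _)
  rw [integral_sub i2 i4, integral_sub i3 (integrable_const _),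
    integral_const_mul, hc.integral_quadForm, ← sq (Q * Q), trace_sq_eq_frobNorm_sq hA]
  simp only [integral_const, probReal_univ, one_smul, zero_add] at hsq ⊢
  linarith

/-- The centered square rarely exceeds `n` in squared norm. -/
lemma measure_norm_conjMap_gt_le (hc : IsCenteredLaw ν 1)
    (h : TiltedFourthMomentBound ν τ ρ) (hτ : 0 ≤ τ) (hρ : 0 < ρ) (hQ : Qᵀ = Q) {n : ℕ}
    (hn : 0 < n) (hr : 0 < (Q * Q).trace) {l : ℝ}
    (hl : l + Real.log n ≤ ρ / (2 * (Q * Q).trace) * √n - ρ - τ * ρ ^ 2 / 8) :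
    ν {x | (n : ℝ) < ‖conjMap Q (centeredSq x)‖ ^ 2} ≤ ENNReal.ofReal (Real.exp (-l) / n) := by
  have hn' : (0 : ℝ) < n := by exact_mod_cast hn
  set r := (Q * Q).trace with hrdef
  -- The largest multiple allowed by $\|sQ^2\|_F\le s\,\mathrm{Tr}\,Q^2=\rho/2$. It turns the offset
  -- $2\,\mathrm{Tr}\,Q^2$ into $\rho$, and the quadratic correction is at most $\tau\rho^2/8$.
  set s := ρ / (2 * r) with hs
  have hs0 : 0 < s := by positivity
  have hsr : s * r = ρ / 2 := by rw [hs]; field_simp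
  have hfr : frobNorm (s • (Q * Q)) ≤ ρ / 2 := by
    rw [frobNorm_smul, abs_of_pos hs0, ← hsr]
    exact mul_le_mul_of_nonneg_left (frobNorm_mul_self_le_trace hQ) hs0.le
  have key := measure_lt_le_of_lintegral_exp_le_one (by fun_prop)
    (lintegral_exp_centeredQuad_le hc h hτ hρ hfr) (l + Real.log n)
  have hexp : Real.exp (-(l + Real.log n)) = Real.exp (-l) / n := by
    rw [neg_add, ← sub_eq_add_neg, Real.exp_sub, Real.exp_log hn']
  rw [hexp] at key
  refine le_trans (measure_mono fun x hx => ?_) key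
  simp only [Set.mem_ofPred_eq] at hx ⊢
  have h1 : √(n : ℝ) < ‖conjMap Q (centeredSq x)‖ := by
    rw [Real.sqrt_lt' (lt_of_le_of_ne (norm_nonneg _) ?_)]
    · exact hx
    · intro h0; rw [← h0] at hx; simp at hx; linarith
  have h2 := h1.trans_le (norm_conjMap_centeredSq_le hQ x)
  have h3 : s * √n < s * (centeredQuad (Q * Q) x + 2 * r) := mul_lt_mul_of_pos_left h2 hs0
  have h4 : frobNorm (s • (Q * Q)) ^ 2 ≤ (ρ / 2) ^ 2 :=
    pow_le_pow_left₀ (frobNorm_nonneg _) hfr 2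
  have h5 : τ / 2 * frobNorm (s • (Q * Q)) ^ 2 ≤ τ / 2 * (ρ / 2) ^ 2 := by gcongr
  rw [centeredQuad_smul]
  nlinarith

end Whitened

/-! ### Whitening, the normalized root and effective ranks -/

section Whitening

variable {d : ℕ}

open scoped MatrixOrder in
lemma sqrt_mul_sqrt {S : Matrix (Fin d) (Fin d) ℝ} (hS : S.PosDef) :
    CFC.sqrt S * CFC.sqrt S = S :=
  CFC.sqrt_mul_sqrt_self S (Matrix.nonneg_iff_posSemidef.2 hS.posSemidef)

open scoped MatrixOrder in
lemma transpose_sqrt (S : Matrix (Fin d) (Fin d) ℝ) : (CFC.sqrt S)ᵀ = CFC.sqrt S := by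
  have := (Matrix.nonneg_iff_posSemidef.1 (CFC.sqrt_nonneg S)).isHermitian.eq
  rwa [Matrix.conjTranspose_eq_transpose_of_trivial] at this

open scoped MatrixOrder in
lemma isUnit_det_sqrt {S : Matrix (Fin d) (Fin d) ℝ} (hS : S.PosDef) :
    IsUnit (CFC.sqrt S).det := by
  have h1 : (CFC.sqrt S).det * (CFC.sqrt S).det = S.det := by
    rw [← Matrix.det_mul, sqrt_mul_sqrt hS]
  exact isUnit_of_mul_isUnit_left (h1 ▸ (hS.det_pos.ne'.isUnit))

open scoped MatrixOrder in
lemma sqrt_mulVec_whiten {S : Matrix (Fin d) (Fin d) ℝ} (hS : S.PosDef) (x : Fin d → ℝ) :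
    CFC.sqrt S *ᵥ whiten S x = x := by
  rw [whiten, Matrix.mulVec_mulVec, Matrix.mul_nonsing_inv _ (isUnit_det_sqrt hS),
    Matrix.one_mulVec]

lemma measurable_whiten (S : Matrix (Fin d) (Fin d) ℝ) : Measurable (whiten S) := by
  refine measurable_pi_lambda _ fun i => ?_
  simp only [whiten, Matrix.mulVec, dotProduct]
  fun_prop

open scoped MatrixOrder in
lemma IsCenteredLaw.map_whiten {μ : Measure (Fin d → ℝ)} {S : Matrix (Fin d) (Fin d) ℝ}
    (hμ : IsCenteredLaw μ S) (hS : S.PosDef) : IsCenteredLaw (μ.map (whiten S)) 1 := by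
  have := hμ.prob
  have hm := measurable_whiten S
  set T := (CFC.sqrt S)⁻¹ with hT
  have hap : ∀ i, (fun x => whiten S x i) = fun x => ∑ j, T i j * x j := fun i => rfl
  have hlp : ∀ i, MemLp (fun x => whiten S x i) 2 μ := fun i => by
    rw [hap]
    exact memLp_finsetSum _ fun j _ => (hμ.memLp j).const_mul _
  refine ⟨Measure.isProbabilityMeasure_map hm.aemeasurable, fun i => ?_, fun i => ?_,
    fun i j => ?_⟩
  · rw [memLp_map_measure_iff (measurable_pi_apply i).aestronglyMeasurable hm.aemeasurable]
    exact hlp i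
  · rw [integral_map hm.aemeasurable (measurable_pi_apply i).aestronglyMeasurable]
    simp only [whiten, Matrix.mulVec, dotProduct]
    rw [integral_finsetSum _ fun j _ => ((hμ.memLp j).integrable (by norm_num)).const_mul _]
    simp [integral_const_mul, hμ.mean_zero]
  · rw [integral_map hm.aemeasurable (by fun_prop)]
    have h1 : ∀ x, whiten S x i * whiten S x j = ∑ a, ∑ b, T i a * T j b * (x a * x b) := by
      intro x
      simp only [whiten, Matrix.mulVec, dotProduct, ← hT]
      rw [Finset.sum_mul_sum]
      exact Finset.sum_congr rfl fun a _ => Finset.sum_congr rfl fun b _ => by ring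
    have hint : ∀ a b, Integrable (fun x : Fin d → ℝ => T i a * T j b * (x a * x b)) μ :=
      fun a b => ((hμ.memLp a).integrable_mul (hμ.memLp b)).const_mul _
    simp_rw [h1]
    rw [integral_finsetSum _ fun a _ => integrable_finsetSum _ fun b _ => hint a b]
    simp_rw [integral_finsetSum _ fun b _ => hint _ b, integral_const_mul, hμ.cov_eq]
    have hTt : Tᵀ = T := by rw [hT, Matrix.transpose_nonsing_inv, transpose_sqrt]
    have hTST : T * S * T = 1 := by
      nth_rw 1 [← sqrt_mul_sqrt hS]
      rw [← Matrix.mul_assoc, hT, Matrix.nonsing_inv_mul _ (isUnit_det_sqrt hS), Matrix.one_mul,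
        Matrix.mul_nonsing_inv _ (isUnit_det_sqrt hS)]
    rw [← hTST]
    simp only [Matrix.mul_apply, Finset.sum_mul]
    rw [Finset.sum_comm]
    refine Finset.sum_congr rfl fun b _ => Finset.sum_congr rfl fun a _ => ?_
    have : T j b = T b j := by rw [← Matrix.transpose_apply T, hTt]
    rw [this]
    ring

/-- The positive square root of a matrix, scaled to have unit norm. -/
noncomputable def unitRoot (S : Matrix (Fin d) (Fin d) ℝ) : Matrix (Fin d) (Fin d) ℝ :=
  open scoped MatrixOrder in (√(opNorm S))⁻¹ • CFC.sqrt S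

lemma transpose_unitRoot (S : Matrix (Fin d) (Fin d) ℝ) : (unitRoot S)ᵀ = unitRoot S := by
  rw [unitRoot, Matrix.transpose_smul, transpose_sqrt]

lemma unitRoot_mul_self {S : Matrix (Fin d) (Fin d) ℝ} (hS : S.PosDef) :
    unitRoot S * unitRoot S = (opNorm S)⁻¹ • S := by
  rw [unitRoot, Matrix.smul_mul, Matrix.mul_smul, sqrt_mul_sqrt hS, smul_smul, ← mul_inv,
    Real.mul_self_sqrt (opNorm_nonneg S)]

lemma opNorm_le_frobNorm (A : Matrix (Fin d) (Fin d) ℝ) : opNorm A ≤ frobNorm A := by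
  rw [opNorm, Matrix.l2_opNorm_def]
  refine ContinuousLinearMap.opNorm_le_bound _ (frobNorm_nonneg A) fun v => ?_
  refine abs_le_of_sq_le_sq' ?_ (mul_nonneg (frobNorm_nonneg A) (norm_nonneg v)) |>.2
  rw [mul_pow, EuclideanSpace.norm_sq_eq, EuclideanSpace.norm_sq_eq, frobNorm_sq, Finset.sum_mul]
  refine Finset.sum_le_sum fun i _ => ?_
  simp only [Real.norm_eq_abs, sq_abs]
  have := Finset.sum_mul_sq_le_sq_mul_sq Finset.univ (A i) v.ofLp
  exact this

lemma opNorm_pos [NeZero d] {S : Matrix (Fin d) (Fin d) ℝ} (hS : S.PosDef) : 0 < opNorm S := by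
  let := Matrix.instL2OpNormedAddCommGroup (m := Fin d) (n := Fin d) (𝕜 := ℝ)
  refine norm_pos_iff.2 fun h => ?_
  have := hS.trace_pos
  rw [h] at this
  simp at this

lemma opNorm_unitRoot [NeZero d] {S : Matrix (Fin d) (Fin d) ℝ} (hS : S.PosDef) :
    opNorm (unitRoot S) = 1 := by
  have h := opNorm_sq_of_isSymm (transpose_unitRoot S)
  rw [sq, unitRoot_mul_self hS, opNorm_smul, abs_of_pos (inv_pos.2 (opNorm_pos hS)),
    inv_mul_cancel₀ (opNorm_pos hS).ne'] at h
  exact (pow_eq_one_iff_of_nonneg (opNorm_nonneg _) two_ne_zero).1 h.symm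

lemma trace_unitRoot {S : Matrix (Fin d) (Fin d) ℝ} (hS : S.PosDef) :
    (unitRoot S * unitRoot S).trace = effRank S := by
  rw [unitRoot_mul_self hS, Matrix.trace_smul, effRank, smul_eq_mul, div_eq_inv_mul]

/-- As $Q^2=\Sigma/\|\Sigma\|$, this is $\mathrm{Tr}(\Sigma^2)/\|\Sigma\|^2$, and
$\|\Sigma\|^2=\|\Sigma^2\|$ by symmetry. -/
lemma frobNorm_unitRoot {S : Matrix (Fin d) (Fin d) ℝ} (hS : S.PosDef) :
    frobNorm (unitRoot S * unitRoot S) ^ 2 = effRank (S ^ 2) := by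
  have hSt : Sᵀ = S := by
    have := hS.isHermitian.eq
    rwa [Matrix.conjTranspose_eq_transpose_of_trivial] at this
  rw [unitRoot_mul_self hS, frobNorm_smul, effRank, trace_sq_eq_frobNorm_sq hSt,
    opNorm_sq_of_isSymm hSt, mul_pow, sq_abs, inv_pow, div_eq_inv_mul]

lemma effRank_sq_nonneg {S : Matrix (Fin d) (Fin d) ℝ} (hS : S.PosDef) : 0 ≤ effRank (S ^ 2) := by
  rw [← frobNorm_unitRoot hS]; positivity

lemma effRank_sq_le [NeZero d] {S : Matrix (Fin d) (Fin d) ℝ} (hS : S.PosDef) :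
    effRank (S ^ 2) ≤ effRank S := by
  rw [← frobNorm_unitRoot hS, ← trace_unitRoot hS, trace_mul_self_eq (transpose_unitRoot S)]
  refine pow_le_pow_left₀ (frobNorm_nonneg _) ?_ 2
  have := frobNorm_mul_le_left (unitRoot S) (unitRoot S)
  rwa [opNorm_unitRoot hS, one_mul] at this

lemma one_le_effRank [NeZero d] {S : Matrix (Fin d) (Fin d) ℝ} (hS : S.PosDef) :
    1 ≤ effRank S := by
  rw [← trace_unitRoot hS, trace_mul_self_eq (transpose_unitRoot S)]
  have := opNorm_le_frobNorm (unitRoot S)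
  rw [opNorm_unitRoot hS] at this
  exact one_le_pow₀ this

end Whitening

/-! ### From the sample covariance to the abstract sum -/

section Sample

variable {d n : ℕ} {Ω : Type*} [MeasurableSpace Ω] {P : Measure Ω}
  {X : Fin n → Ω → (Fin d → ℝ)} {μ : Measure (Fin d → ℝ)} {S : Matrix (Fin d) (Fin d) ℝ} {τ ρ : ℝ}

/-- A law provides only almost everywhere measurability, while the σ-algebras of the past require
measurable variables; a modification changes neither the probabilities nor the mean. -/
lemma IsRegularSample.exists_measurable (h : IsRegularSample P X μ S τ ρ) :
    ∃ X' : Fin n → Ω → (Fin d → ℝ), IsRegularSample P X' μ S τ ρ ∧ (∀ k, Measurable (X' k)) ∧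
      sqErr X S =ᵐ[P] sqErr X' S := by
  have hae : ∀ k, X k =ᵐ[P] (h.hasLaw k).aemeasurable.mk := fun k =>
    (h.hasLaw k).aemeasurable.ae_eq_mk
  refine ⟨fun k => (h.hasLaw k).aemeasurable.mk,
    ⟨h.prob, fun k => (h.hasLaw k).congr (hae k).symm, h.indep.congr hae, h.centered, h.posDef,
      h.regular⟩, fun k => (h.hasLaw k).aemeasurable.measurable_mk, ?_⟩
  filter_upwards [ae_all_iff.2 hae] with ω hω
  simp only [sqErr, sampleCov, hω]

lemma integral_sum_sq_of_indep [IsProbabilityMeasure P] {Z : Fin n → Ω → ℝ}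
    (hZ : ∀ k, MemLp (Z k) 2 P) (hind : iIndepFun Z P) (h0 : ∀ k, ∫ ω, Z k ω ∂P = 0) :
    ∫ ω, (∑ k, Z k ω) ^ 2 ∂P = ∑ k, ∫ ω, Z k ω ^ 2 ∂P := by
  have h1 := IndepFun.variance_sum (s := Finset.univ) (fun k _ => hZ k)
    fun i _ j _ hij => hind.indepFun hij
  have hm : ∫ ω, (∑ k, Z k) ω ∂P = 0 := by
    simp only [Finset.sum_apply]
    rw [integral_finsetSum _ fun k _ => (hZ k).integrable (by norm_num)]
    simp [h0]
  rw [variance_of_integral_eq_zero (memLp_finsetSum' _ fun k _ => hZ k).aemeasurable hm] at h1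
  simp only [Finset.sum_apply] at h1
  rw [h1]
  exact Finset.sum_congr rfl fun k _ =>
    variance_of_integral_eq_zero (hZ k).aemeasurable (h0 k)

-- $Q\,\Sigma^{-1/2}X=X/\sqrt{\|\Sigma\|}$ and $Q^2=\Sigma/\|\Sigma\|$, so each summand on the right
-- is $(XX^\top-\Sigma)/\|\Sigma\|$.
omit [MeasurableSpace Ω] in
lemma vec_sampleCov_sub [NeZero d] (hS : S.PosDef) (hn : 0 < n) (ω : Ω) :
    vec (sampleCov X ω - S) = (opNorm S / n) •
      ∑ k, conjMap (unitRoot S) (centeredSq (whiten S (X k ω))) := by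
  have hs := opNorm_pos hS
  have hn' : (n : ℝ) ≠ 0 := by exact_mod_cast hn.ne'
  have h1 : ∀ k, conjMap (unitRoot S) (centeredSq (whiten S (X k ω))) =
      (opNorm S)⁻¹ • (vec (Matrix.vecMulVec (X k ω) (X k ω)) - vec S) := by
    intro k
    have hv : unitRoot S *ᵥ whiten S (X k ω) = (√(opNorm S))⁻¹ • X k ω := by
      rw [unitRoot, Matrix.smul_mulVec, sqrt_mulVec_whiten hS]
    rw [conjMap_centeredSq (transpose_unitRoot S), unitRoot_mul_self hS, hv,
      Matrix.smul_vecMulVec, Matrix.vecMulVec_smul, smul_smul, ← mul_inv,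
      Real.mul_self_sqrt (opNorm_nonneg S), ← smul_sub]
    rfl
  simp_rw [h1, ← Finset.smul_sum, smul_smul, Finset.sum_sub_distrib]
  ext p
  simp [sampleCov, Matrix.sum_apply]
  field_simp

omit [MeasurableSpace Ω] in
lemma sqErr_eq [NeZero d] (hS : S.PosDef) (hn : 0 < n) (ω : Ω) :
    sqErr X S ω = opNorm S ^ 2 / n *
      (‖∑ k, conjMap (unitRoot S) (centeredSq (whiten S (X k ω)))‖ ^ 2 / n) := by
  have hn' : (n : ℝ) ≠ 0 := by exact_mod_cast hn.ne'
  rw [sqErr, ← norm_vec, vec_sampleCov_sub hS hn, norm_smul, mul_pow, Real.norm_eq_abs, sq_abs]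
  field_simp

end Sample

section Sample

variable {d n : ℕ} {Ω : Type*} [MeasurableSpace Ω] {P : Measure Ω}
  {X : Fin n → Ω → (Fin d → ℝ)} {μ : Measure (Fin d → ℝ)} {S : Matrix (Fin d) (Fin d) ℝ} {τ ρ : ℝ}

lemma LocallySubgaussian.comp {α H : Type*} [NormedAddCommGroup H] [InnerProductSpace ℝ H]
    [MeasurableSpace H] [BorelSpace H] [SecondCountableTopology H] [MeasurableSpace α]
    {ν : Measure α} {b : α → H} (hb : Measurable b) (hν : LocallySubgaussian b ν τ ρ) {ξ : Ω → α}
    (hξ : MeasurePreserving ξ P ν) : LocallySubgaussian (b ∘ ξ) P τ ρ := by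
  intro v hv
  refine le_trans (le_of_eq ?_) (hν v hv)
  exact hξ.lintegral_comp (f := fun x =>
    ENNReal.ofReal (Real.exp (⟪b x, v⟫ - τ / 2 * ‖v‖ ^ 2))) (by fun_prop)

/-- The mean of the squared norm of the rescaled matrix `X Xᵀ - S`. -/
noncomputable def meanSq (μ : Measure (Fin d → ℝ)) (S : Matrix (Fin d) (Fin d) ℝ) : ℝ :=
  ∫ x, ‖conjMap (unitRoot S) (centeredSq x)‖ ^ 2 ∂(μ.map (whiten S))

lemma IsRegularSample.measurePreserving (h : IsRegularSample P X μ S τ ρ)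
    (hX : ∀ k, Measurable (X k)) (k : Fin n) :
    MeasurePreserving (fun ω => whiten S (X k ω)) P (μ.map (whiten S)) :=
  ((measurable_whiten S).measurePreserving μ).comp ((h.hasLaw k).measurePreserving (hX k))

lemma IsRegularSample.iIndepFun_centeredSq (h : IsRegularSample P X μ S τ ρ) :
    iIndepFun (fun k ω => centeredSq (whiten S (X k ω))) P :=
  h.indep.comp (fun _ x => centeredSq (whiten S x)) fun _ =>
    measurable_centeredSq.comp (measurable_whiten S)

lemma IsRegularSample.integrable_sq_norm_sum (h : IsRegularSample P X μ S τ ρ)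
    (hX : ∀ k, Measurable (X k)) (hρ : 0 ≤ ρ) :
    Integrable (fun ω => ‖∑ k, conjMap (unitRoot S) (centeredSq (whiten S (X k ω)))‖ ^ 2) P := by
  have hc := h.centered.map_whiten h.posDef
  have hi : ∀ k, Integrable (fun ω =>
      ‖conjMap (unitRoot S) (centeredSq (whiten S (X k ω)))‖ ^ 2) P := fun k =>
    (h.measurePreserving hX k).integrable_comp_of_integrable
      (integrable_norm_conjMap_sq hc h.regular hρ (transpose_unitRoot S))
  have hm : ∀ k, Measurable fun ω => conjMap (unitRoot S) (centeredSq (whiten S (X k ω))) :=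
    fun k => (conjMap (unitRoot S)).measurable.comp
      (measurable_centeredSq.comp ((measurable_whiten S).comp (hX k)))
  refine ((integrable_finsetSum Finset.univ fun k _ => hi k).const_mul (n : ℝ)).mono'
    ((Finset.measurable_fun_sum _ fun k _ => hm k).norm.pow_const 2).aestronglyMeasurable
    (ae_of_all _ fun ω => ?_)
  rw [Real.norm_eq_abs, abs_of_nonneg (sq_nonneg _)]
  refine (pow_le_pow_left₀ (norm_nonneg _) (norm_sum_le _ _) 2).trans ?_
  simpa using sq_sum_le_card_mul_sum_sq (s := Finset.univ)
    (f := fun k => ‖conjMap (unitRoot S) (centeredSq (whiten S (X k ω)))‖)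

/-- Every entry is a sum of independent centered variables, so the cross terms vanish. The mean is
therefore exact for every sample size. -/
lemma IsRegularSample.integral_sq_norm_sum (h : IsRegularSample P X μ S τ ρ)
    (hX : ∀ k, Measurable (X k)) (hρ : 0 ≤ ρ) :
    ∫ ω, ‖∑ k, conjMap (unitRoot S) (centeredSq (whiten S (X k ω)))‖ ^ 2 ∂P =
      n * meanSq μ S := by
  have hc := h.centered.map_whiten h.posDef
  have hP := h.prob
  have hν := hc.prob
  have hQ := transpose_unitRoot S
  set V : Fin d × Fin d → Matrix (Fin d) (Fin d) ℝ := fun p =>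
    Matrix.vecMulVec (unitRoot S p.1) (unitRoot S p.2) with hV
  have hmp := h.measurePreserving hX
  have hlp : ∀ p, MemLp (centeredQuad (V p)) 2 (μ.map (whiten S)) := fun p =>
    (memLp_two_iff_integrable_sq (measurable_centeredQuad _).aestronglyMeasurable).2
      (integrable_centeredQuad_sq hc h.regular hρ (V p))
  have hsum : ∀ ω, ‖∑ k, conjMap (unitRoot S) (centeredSq (whiten S (X k ω)))‖ ^ 2 =
      ∑ p, (∑ k, centeredQuad (V p) (whiten S (X k ω))) ^ 2 := by
    intro ω
    rw [EuclideanSpace.norm_sq_eq]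
    refine Finset.sum_congr rfl fun p _ => ?_
    rw [Real.norm_eq_abs, sq_abs]
    simp [conjMap_centeredSq_apply hQ, hV]
  have hlpk : ∀ p k, MemLp (fun ω => centeredQuad (V p) (whiten S (X k ω))) 2 P := fun p k =>
    (hlp p).comp_measurePreserving (hmp k)
  have hcoord : ∀ p, ∫ ω, (∑ k, centeredQuad (V p) (whiten S (X k ω))) ^ 2 ∂P =
      n * ∫ x, centeredQuad (V p) x ^ 2 ∂(μ.map (whiten S)) := by
    intro p
    rw [integral_sum_sq_of_indep (hlpk p)
      (h.indep.comp (fun _ x => centeredQuad (V p) (whiten S x)) fun _ =>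
        (measurable_centeredQuad _).comp (measurable_whiten S)) fun k => ?_]
    · have : ∀ k, ∫ ω, centeredQuad (V p) (whiten S (X k ω)) ^ 2 ∂P =
          ∫ x, centeredQuad (V p) x ^ 2 ∂(μ.map (whiten S)) := fun k =>
        (hmp k).hasLaw.integral_comp
          ((measurable_centeredQuad _).pow_const 2).aestronglyMeasurable
      simp [this]
    · exact ((hmp k).hasLaw.integral_comp
        (measurable_centeredQuad (V p)).aestronglyMeasurable).trans
        (integral_centeredQuad hc h.regular hρ _)
  simp_rw [hsum]
  rw [integral_finsetSum _ fun p _ =>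
    (memLp_finsetSum _ fun k _ => hlpk p k).integrable_sq]
  simp_rw [hcoord, meanSq, EuclideanSpace.norm_sq_eq, Real.norm_eq_abs, sq_abs,
    conjMap_centeredSq_apply hQ]
  rw [integral_finsetSum _ fun p _ => integrable_centeredQuad_sq hc h.regular hρ _,
    Finset.mul_sum]

lemma IsRegularSample.le_meanSq (h : IsRegularSample P X μ S τ ρ) (hρ : 0 ≤ ρ) :
    effRank S ^ 2 - effRank (S ^ 2) ≤ meanSq μ S := by
  rw [← trace_unitRoot h.posDef, ← frobNorm_unitRoot h.posDef]
  exact le_integral_norm_conjMap_sq (h.centered.map_whiten h.posDef) h.regular hρ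
    (transpose_unitRoot S)

lemma conjMap_conjMap (Q : Matrix (Fin d) (Fin d) ℝ) (v : EuclideanSpace ℝ (Fin d × Fin d)) :
    conjMap Q (conjMap Q v) = conjMap (Q * Q) v := by
  rw [← vec_unvec v, conjMap_vec, conjMap_vec, conjMap_vec]
  simp only [Matrix.mul_assoc]

/-- The conditions on the sample size under which the squared error concentrates at level `l`. -/
structure IsLargeSample (n : ℕ) (τ ρ r l : ℝ) : Prop where
  pos : 0 < n
  one_le : 1 ≤ l
  moment : (8 * τ ^ 2 + 128) * r ^ 4 ≤ n
  tail : l + Real.log n ≤ ρ / (2 * r) * √n - ρ - τ * ρ ^ 2 / 8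
  radius : (10 * τ + 5) * (r ^ 2 + l) ≤ τ ^ 2 * ρ ^ 2 * n
  radius' : (10 * τ + 5) * (r ^ 2 + l) ≤ ρ ^ 2 / 4 * n

lemma IsRegularSample.measure_sq_norm_sum_le [NeZero d] (h : IsRegularSample P X μ S τ ρ)
    (hX : ∀ k, Measurable (X k)) (hτ : 0 < τ) (hρ : 0 < ρ) {l : ℝ}
    (hl : IsLargeSample n τ ρ (effRank S) l) :
    P {ω | (4 + 2 * τ * (10 * τ + 5)) * max (effRank (S ^ 2) * √l) l <
      |‖∑ k, conjMap (unitRoot S) (centeredSq (whiten S (X k ω)))‖ ^ 2 / n - meanSq μ S|} ≤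
      7 * ENNReal.ofReal (Real.exp (-l)) := by
  have hc := h.centered.map_whiten h.posDef
  have hP := h.prob
  have hν := hc.prob
  have hQ := transpose_unitRoot S
  have hmp := h.measurePreserving hX
  have hr := one_le_effRank h.posDef
  have hq0 := effRank_sq_nonneg h.posDef
  have hqr : effRank (S ^ 2) ^ 2 ≤ effRank S ^ 2 :=
    pow_le_pow_left₀ hq0 (effRank_sq_le h.posDef) 2
  have hm2 := (measurable_norm_conjMap_centeredSq (unitRoot S)).pow_const 2
  have hτ5 : 0 < 10 * τ + 5 := by positivity
  have hrad : (10 * τ + 5) * (effRank (S ^ 2) ^ 2 + l) ≤ (10 * τ + 5) * (effRank S ^ 2 + l) := by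
    gcongr
  refine measure_sq_norm_sum_sub_le hl.pos
    (B := fun k ω => centeredSq (whiten S (X k ω))) (ρ := ρ / 2)
    (fun k => measurable_centeredSq.comp (hmp k).measurable) h.iIndepFun_centeredSq
    (fun k => (locallySubgaussian_centeredSq hc h.regular hτ.le hρ).comp measurable_centeredSq
      (hmp k)) hτ (by positivity) (conjMap (unitRoot S)) (inner_conjMap hQ)
    (norm_conjMap_le hQ (opNorm_unitRoot h.posDef).le) hq0 hl.one_le
    (fun k => (hmp k).integrable_comp_of_integrable
      (integrable_norm_conjMap_sq hc h.regular hρ.le hQ))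
    (fun k => (hmp k).integrable_comp_of_integrable
      (integrable_norm_conjMap_pow_four hc h.regular hρ.le hQ))
    (fun k => (hmp k).hasLaw.integral_comp hm2.aestronglyMeasurable)
    (fun k => ?_) (fun k => ?_) (fun k => ?_) ?_ ?_
  · refine le_trans (le_of_eq ((hmp k).hasLaw.integral_comp
      (hm2.pow_const 2).aestronglyMeasurable)) ?_
    refine (integral_norm_conjMap_pow_four_le hc h.regular hρ.le hQ).trans ?_
    rw [trace_unitRoot h.posDef]
    exact hl.moment
  -- Applying `S` twice is conjugation by $Q^2$, so the second-moment bound yields $\tau\,\mathtt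
  -- r(\Sigma^2)^2$.
  · simp_rw [conjMap_conjMap]
    refine le_trans (le_of_eq ((hmp k).hasLaw.integral_comp
      ((measurable_norm_conjMap_centeredSq _).pow_const 2).aestronglyMeasurable)) ?_
    rw [← frobNorm_unitRoot h.posDef]
    exact integral_norm_conjMap_sq_le hc h.regular hτ.le hρ.le (transpose_mul_self hQ)
  · refine le_trans (le_of_eq ((hmp k).measure_preimage
      (measurableSet_lt measurable_const hm2).nullMeasurableSet)) ?_
    refine measure_norm_conjMap_gt_le hc h.regular hτ.le hρ hQ hl.pos ?_ ?_
    · rw [trace_unitRoot h.posDef]; linarith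
    · rw [trace_unitRoot h.posDef]; exact hl.tail
  · linarith [hl.radius]
  · linarith [hl.radius']

theorem IsRegularSample.integrable_sqErr (h : IsRegularSample P X μ S τ ρ) (hρ : 0 ≤ ρ) :
    Integrable (sqErr X S) P := by
  have hP := h.prob
  obtain ⟨X', h', hX', hae⟩ := h.exists_measurable
  refine Integrable.congr ?_ hae.symm
  rcases Nat.eq_zero_or_pos n with rfl | hn
  · have : sqErr X' S = fun _ => frobNorm (0 - S) ^ 2 := by
      funext ω; simp [sqErr, sampleCov]
    rw [this]
    exact integrable_const _
  rcases Nat.eq_zero_or_pos d with rfl | hd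
  · have : sqErr X' S = fun _ => 0 := by
      funext ω; simp [sqErr, frobNorm_sq]
    rw [this]
    exact integrable_const _
  have : NeZero d := ⟨hd.ne'⟩
  rw [show sqErr X' S = _ from funext (sqErr_eq h'.posDef hn)]
  exact ((h'.integrable_sq_norm_sum hX' hρ).div_const _).const_mul _

theorem IsRegularSample.meanSqErr_eq [NeZero d] (h : IsRegularSample P X μ S τ ρ) (hρ : 0 ≤ ρ)
    (hn : 0 < n) : meanSqErr P X S = opNorm S ^ 2 / n * meanSq μ S := by
  obtain ⟨X', h', hX', hae⟩ := h.exists_measurable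
  have hn' : (n : ℝ) ≠ 0 := by exact_mod_cast hn.ne'
  rw [meanSqErr, integral_congr_ae hae]
  simp_rw [sqErr_eq h'.posDef hn]
  rw [integral_const_mul, integral_div, h'.integral_sq_norm_sum hX' hρ]
  field_simp

theorem IsRegularSample.measure_sqErr_sub_le [NeZero d] (h : IsRegularSample P X μ S τ ρ)
    (hτ : 0 < τ) (hρ : 0 < ρ) {l : ℝ} (hl : IsLargeSample n τ ρ (effRank S) l) :
    P {ω | (4 + 2 * τ * (10 * τ + 5)) *
        (opNorm S ^ 2 / n * max (effRank (S ^ 2) * √l) l) < |sqErr X S ω - meanSqErr P X S|} ≤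
      7 * ENNReal.ofReal (Real.exp (-l)) := by
  obtain ⟨X', h', hX', hae⟩ := h.exists_measurable
  refine le_trans (measure_mono_ae ?_) (h'.measure_sq_norm_sum_le hX' hτ hρ hl)
  have hn' : (0 : ℝ) < n := by exact_mod_cast hl.pos
  have hs : 0 < opNorm S ^ 2 / n := by have := opNorm_pos h.posDef; positivity
  filter_upwards [hae] with ω hω hlt
  change _ < _ at hlt
  change _ < _
  rw [hω, sqErr_eq h.posDef hl.pos, h.meanSqErr_eq hρ.le hl.pos, ← mul_sub, abs_mul,
    abs_of_pos hs, mul_left_comm] at hlt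
  exact lt_of_mul_lt_mul_left hlt hs.le

end Sample

/-! ### Sample size and confidence level -/

/-- A sample is large as soon as its size dominates the sixth power of the effective rank. -/
lemma exists_isLargeSample {τ ρ : ℝ} (hτ : 0 < τ) (hρ : 0 < ρ) :
    ∃ c : ℝ, 0 < c ∧ ∀ (n : ℕ) (r l l' : ℝ), 1 ≤ r → 1 ≤ l → l ≤ 3 * l' → 1 / 2 ≤ l' →
      c * (r ^ 6 + r ^ 2 * l' ^ 2) ≤ n → IsLargeSample n τ ρ r l := by
  obtain ⟨k, hk1, k1, k2, k3, k4, k5⟩ : ∃ k : ℝ, 1 ≤ k ∧ 18 / ρ ≤ k ∧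
      6 * (ρ + τ * ρ ^ 2 / 8) / ρ ≤ k ∧ 8 * τ ^ 2 + 128 ≤ k ∧
      6 * (10 * τ + 5) / (τ ^ 2 * ρ ^ 2) ≤ k ∧ 24 * (10 * τ + 5) / ρ ^ 2 ≤ k := by
    have h1 : 0 < 18 / ρ := by positivity
    have h2 : 0 < 6 * (ρ + τ * ρ ^ 2 / 8) / ρ := by positivity
    have h3 : 0 < 8 * τ ^ 2 + 128 := by positivity
    have h4 : 0 < 6 * (10 * τ + 5) / (τ ^ 2 * ρ ^ 2) := by positivity
    have h5 : 0 < 24 * (10 * τ + 5) / ρ ^ 2 := by positivity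
    refine ⟨1 + 18 / ρ + 6 * (ρ + τ * ρ ^ 2 / 8) / ρ + (8 * τ ^ 2 + 128) +
      6 * (10 * τ + 5) / (τ ^ 2 * ρ ^ 2) + 24 * (10 * τ + 5) / ρ ^ 2, ?_, ?_, ?_, ?_, ?_, ?_⟩ <;>
    linarith
  rw [div_le_iff₀ (by positivity)] at k1 k2 k4 k5
  have hk3 : k ≤ k ^ 3 := le_self_pow₀ hk1 (by norm_num)
  have hk6 : k ≤ k ^ 6 := le_self_pow₀ hk1 (by norm_num)
  have hk0 : 0 < k := by linarith
  refine ⟨k ^ 6, by positivity, fun n r l l' hr hl hll' hl' hn => ?_⟩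
  have hl'0 : 0 < l' := by linarith
  have hr0 : 0 < r := by linarith
  have hrl0 : 0 ≤ r ^ 2 * l' ^ 2 := by positivity
  have hr60 : 0 < r ^ 6 := by positivity
  have hk60 : 0 < k ^ 6 := by positivity
  have hn6 : k ^ 6 * r ^ 6 ≤ n :=
    (mul_le_mul_of_nonneg_left (le_add_of_nonneg_right hrl0) hk60.le).trans hn
  have hnl : k ^ 6 * (r ^ 2 * l' ^ 2) ≤ n :=
    (mul_le_mul_of_nonneg_left (le_add_of_nonneg_left hr60.le) hk60.le).trans hn
  have hn0 : (0 : ℝ) < n := lt_of_lt_of_le (by positivity) hn6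
  have hrad : r ^ 2 + l ≤ 6 * (r ^ 6 + r ^ 2 * l' ^ 2) := by
    have e1 : r ^ 2 ≤ r ^ 6 := pow_le_pow_right₀ hr (by norm_num)
    have e2 : l' ^ 2 ≤ r ^ 2 * l' ^ 2 := le_mul_of_one_le_left (sq_nonneg _) (one_le_pow₀ hr)
    have e3 : l ≤ 6 * l' ^ 2 := by nlinarith only [hll', hl']
    linarith
  have hradn : k ^ 6 * (r ^ 2 + l) ≤ 6 * n := by
    have := mul_le_mul_of_nonneg_left hrad hk60.le
    linarith
  refine ⟨by exact_mod_cast hn0, hl, ?_, ?_, ?_, ?_⟩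
  · calc (8 * τ ^ 2 + 128) * r ^ 4 ≤ k ^ 6 * r ^ 6 := by
          have : r ^ 4 ≤ r ^ 6 := pow_le_pow_right₀ hr (by norm_num)
          have : 8 * τ ^ 2 + 128 ≤ k ^ 6 := by linarith
          gcongr
      _ ≤ (n : ℝ) := hn6
  · set v : ℝ := (n : ℝ) ^ (1 / 6 : ℝ) with hv
    have hv0 : 0 < v := Real.rpow_pos_of_pos hn0 _
    have hv6 : v ^ 6 = n := by
      rw [hv, ← Real.rpow_natCast, ← Real.rpow_mul hn0.le]
      norm_num
    have hsq : √(n : ℝ) = v ^ 3 := by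
      rw [← hv6, show v ^ 6 = (v ^ 3) ^ 2 by ring, Real.sqrt_sq (by positivity)]
    have hkr : k * r ≤ v := by
      rw [← hv6, ← mul_pow] at hn6
      exact le_of_pow_le_pow_left₀ (by norm_num) hv0.le hn6
    have hlog : Real.log n ≤ 3 * v ^ 2 := by
      have e1 : Real.log n = 3 * Real.log (v ^ 2) := by
        rw [← hv6, Real.log_pow, Real.log_pow]; push_cast; ring
      have e2 := Real.log_le_sub_one_of_pos (x := v ^ 2) (by positivity)
      linarith
    set w := v ^ 3 / r with hw
    have hw1 : k * v ^ 2 ≤ w := by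
      rw [hw, le_div_iff₀ hr0]
      calc k * v ^ 2 * r = k * r * v ^ 2 := by ring
        _ ≤ v * v ^ 2 := by gcongr
        _ = v ^ 3 := by ring
    have hw2 : k ^ 3 * l' ≤ w := by
      rw [hw, le_div_iff₀ hr0]
      refine abs_le_of_sq_le_sq' ?_ (by positivity) |>.2
      calc (k ^ 3 * l' * r) ^ 2 = k ^ 6 * (r ^ 2 * l' ^ 2) := by ring
        _ ≤ (n : ℝ) := hnl
        _ = (v ^ 3) ^ 2 := by rw [← hv6]; ring
    have hkv : k ≤ v := (le_mul_of_one_le_right hk0.le hr).trans hkr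
    have hw3 : k ≤ w :=
      (le_mul_of_one_le_right hk0.le (one_le_pow₀ (hk1.trans hkv))).trans hw1
    have f1 : 3 * v ^ 2 ≤ ρ / 6 * w := by
      have e1 := mul_le_mul_of_nonneg_left hw1 hρ.le
      have e2 := mul_le_mul_of_nonneg_right k1 (sq_nonneg v)
      linarith
    have f2 : 3 * l' ≤ ρ / 6 * w := by
      have e1 := mul_le_mul_of_nonneg_left ((mul_le_mul_of_nonneg_right hk3 hl'0.le).trans hw2)
        hρ.le
      have e2 := mul_le_mul_of_nonneg_right k1 hl'0.le
      linarith
    have f3 : ρ + τ * ρ ^ 2 / 8 ≤ ρ / 6 * w := by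
      have e1 := mul_le_mul_of_nonneg_left hw3 hρ.le
      linarith
    have f4 : ρ / (2 * r) * √(n : ℝ) = ρ / 2 * w := by rw [hsq, hw]; field_simp
    rw [f4]
    linarith
  · have e1 : 6 * (10 * τ + 5) ≤ k ^ 6 * (τ ^ 2 * ρ ^ 2) :=
      k4.trans (by gcongr)
    have e2 := mul_le_mul_of_nonneg_left hradn (by positivity : 0 ≤ τ ^ 2 * ρ ^ 2)
    have e3 := mul_le_mul_of_nonneg_right e1 (by positivity : 0 ≤ r ^ 2 + l)
    linarith
  · have e1 : 24 * (10 * τ + 5) ≤ k ^ 6 * ρ ^ 2 :=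
      k5.trans (by gcongr)
    have e2 := mul_le_mul_of_nonneg_left hradn (by positivity : 0 ≤ ρ ^ 2)
    have e3 := mul_le_mul_of_nonneg_right e1 (by positivity : 0 ≤ r ^ 2 + l)
    linarith

lemma one_le_log_seven_div {δ : ℝ} (h0 : 0 < δ) (h1 : δ < 1) : 1 ≤ Real.log (7 / δ) := by
  rw [Real.le_log_iff_exp_le (by positivity), le_div_iff₀ h0]
  have := Real.exp_one_lt_d9
  nlinarith [Real.exp_pos 1]

/-- $7/\delta\le(2/\delta)^3$. This passes from the logarithm in the sample size condition to the
one in the error bound. -/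
lemma log_seven_div_le {δ : ℝ} (h0 : 0 < δ) (h1 : δ < 1) :
    Real.log (7 / δ) ≤ 3 * Real.log (2 / δ) := by
  have : 3 * Real.log (2 / δ) = Real.log ((2 / δ) ^ 3) := by rw [Real.log_pow]; norm_num
  rw [this]
  refine Real.log_le_log (by positivity) ?_
  rw [div_pow, div_le_div_iff₀ h0 (by positivity)]
  nlinarith [sq_nonneg δ]

lemma half_le_log_two_div {δ : ℝ} (h0 : 0 < δ) (h1 : δ < 1) : 1 / 2 ≤ Real.log (2 / δ) := by
  have h2 : Real.log 2 ≤ Real.log (2 / δ) := by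
    refine Real.log_le_log two_pos ?_
    rw [le_div_iff₀ h0]; linarith
  linarith [Real.log_two_gt_d9]

/-- Subadditivity of the measure is enough, so neither event has to be measurable. -/
lemma one_sub_le_measureReal {Ω : Type*} [MeasurableSpace Ω] {P : Measure Ω}
    [IsProbabilityMeasure P] {s t : Set Ω} {δ : ℝ} (hδ : 0 ≤ δ) (hs : P s ≤ ENNReal.ofReal δ)
    (hst : sᶜ ⊆ t) : 1 - δ ≤ P.real t := by
  have h1 : P.real s ≤ δ := ENNReal.toReal_le_of_le_ofReal hδ hs
  have h2 : 1 ≤ P.real (s ∪ t) := by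
    have : s ∪ t = Set.univ := by
      rw [← Set.univ_subset_iff, ← Set.union_compl_self s]
      exact Set.union_subset_union_right _ hst
    rw [this, probReal_univ]
  linarith [measureReal_union_le (μ := P) s t]

/-! ### Absolute and relative error bounds -/

section Sample

variable {d n : ℕ} {Ω : Type*} [MeasurableSpace Ω] {P : Measure Ω}
  {X : Fin n → Ω → (Fin d → ℝ)} {μ : Measure (Fin d → ℝ)} {S : Matrix (Fin d) (Fin d) ℝ} {τ ρ : ℝ}

lemma effRank_of_isEmpty (S : Matrix (Fin 0) (Fin 0) ℝ) : effRank S = 0 := by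
  simp [effRank, Matrix.trace]

lemma IsRegularSample.le_meanSqErr [NeZero d] (h : IsRegularSample P X μ S τ ρ) (hρ : 0 ≤ ρ)
    (hn : 0 < n) :
    opNorm S ^ 2 / n * (effRank S ^ 2 - effRank (S ^ 2)) ≤ meanSqErr P X S := by
  rw [h.meanSqErr_eq hρ hn]
  exact mul_le_mul_of_nonneg_left (h.le_meanSq hρ) (by positivity)

lemma mul_sub_one_le_effRank_sq_sub [NeZero d] (hS : S.PosDef) :
    effRank S * (effRank S - 1) ≤ effRank S ^ 2 - effRank (S ^ 2) := by
  linarith [effRank_sq_le hS, sq (effRank S)]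

theorem IsRegularSample.meanSqErr_pos (h : IsRegularSample P X μ S τ ρ) (hρ : 0 ≤ ρ)
    (hr : 1 < effRank S) : 0 < meanSqErr P X S := by
  have hP := h.prob
  rcases Nat.eq_zero_or_pos d with rfl | hd
  · rw [effRank_of_isEmpty] at hr; linarith
  have : NeZero d := ⟨hd.ne'⟩
  have hs := opNorm_pos h.posDef
  -- For $n=0$ the sample covariance is zero and the error is the constant $\|\Sigma\|_F^2$.
  rcases Nat.eq_zero_or_pos n with rfl | hn
  · have h1 : ∀ ω, sqErr X S ω = frobNorm S ^ 2 := fun ω => by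
      have : sampleCov X ω - S = (-1 : ℝ) • S := by simp [sampleCov]
      rw [sqErr, this, frobNorm_smul]
      simp
    have := hs.trans_le (opNorm_le_frobNorm S)
    simp only [meanSqErr, h1, integral_const, probReal_univ, one_smul]
    positivity
  · have hn' : (0 : ℝ) < n := by exact_mod_cast hn
    refine lt_of_lt_of_le ?_ (h.le_meanSqErr hρ hn)
    have := mul_sub_one_le_effRank_sq_sub h.posDef
    have h2 : 0 < effRank S * (effRank S - 1) := mul_pos (by linarith) (by linarith)
    exact mul_pos (by positivity) (by linarith)

/-- An additive error bound turns into a relative one. -/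
lemma abs_div_sub_one_le {e m a g K : ℝ} (ha : 0 < a) (hg : 0 < g) (hm : a * g ≤ m)
    (h : |e - m| ≤ a * K) : |e / m - 1| ≤ K / g := by
  have hm0 : 0 < m := (mul_pos ha hg).trans_le hm
  have hK : 0 ≤ K := nonneg_of_mul_nonneg_right ((abs_nonneg _).trans h) ha
  rw [div_sub_one hm0.ne', abs_div, abs_of_pos hm0, div_le_div_iff₀ hm0 hg]
  calc |e - m| * g ≤ a * K * g := by gcongr
    _ = K * (a * g) := by ring
    _ ≤ K * m := by gcongr

theorem IsRegularSample.one_sub_le_measureReal_sqErr_sub (h : IsRegularSample P X μ S τ ρ)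
    (hτ : 0 < τ) (hρ : 0 < ρ) {δ : ℝ} (h0 : 0 < δ) (h1 : δ < 1)
    (hl : d ≠ 0 → IsLargeSample n τ ρ (effRank S) (Real.log (7 / δ))) :
    1 - δ ≤ P.real {ω | |sqErr X S ω - meanSqErr P X S| ≤ (4 + 2 * τ * (10 * τ + 5)) *
      (opNorm S ^ 2 / n *
        max (effRank (S ^ 2) * √(Real.log (7 / δ))) (Real.log (7 / δ)))} := by
  have hP := h.prob
  -- In dimension zero the effective rank is $0/0=0$ and the size condition is void, but the error
  -- vanishes identically.
  rcases Nat.eq_zero_or_pos d with rfl | hd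
  · have hz : ∀ ω, sqErr X S ω = 0 := fun ω => by simp [sqErr, frobNorm_sq]
    have hmax : 0 ≤ max (effRank (S ^ 2) * √(Real.log (7 / δ))) (Real.log (7 / δ)) :=
      le_max_of_le_right (by linarith [one_le_log_seven_div h0 h1])
    refine one_sub_le_measureReal (s := ∅) h0.le (by simp) fun ω _ => ?_
    simp only [Set.mem_ofPred_eq, meanSqErr, hz, integral_zero, sub_self, abs_zero]
    positivity
  have : NeZero d := ⟨hd.ne'⟩
  refine one_sub_le_measureReal h0.le ((h.measure_sqErr_sub_le hτ hρ (hl hd.ne')).trans ?_)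
    fun ω hω => by rwa [Set.mem_compl_iff, Set.mem_ofPred_eq, not_lt] at hω
  have : Real.exp (-Real.log (7 / δ)) = δ / 7 := by
    rw [Real.exp_neg, Real.exp_log (by positivity), inv_div]
  rw [this, show (7 : ℝ≥0∞) = ENNReal.ofReal 7 by simp, ← ENNReal.ofReal_mul (by norm_num)]
  exact ENNReal.ofReal_le_ofReal (by linarith)

theorem IsRegularSample.one_sub_le_measureReal_div_sub_one
    (h : IsRegularSample P X μ S τ ρ) (hτ : 0 < τ) (hρ : 0 < ρ) {δ : ℝ} (h0 : 0 < δ) (h1 : δ < 1)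
    (hr : 1 < effRank S) (hl : IsLargeSample n τ ρ (effRank S) (Real.log (7 / δ))) {C : ℝ}
    (hC : 4 + 2 * τ * (10 * τ + 5) ≤ C) :
    1 - δ ≤ P.real {ω | |sqErr X S ω / meanSqErr P X S - 1| ≤
      C * max (effRank (S ^ 2) * √(Real.log (7 / δ)) / (effRank S ^ 2 - effRank (S ^ 2)))
        (Real.log (7 / δ) / (effRank S ^ 2 - effRank (S ^ 2)))} := by
  have hP := h.prob
  have hd : d ≠ 0 := by
    rintro rfl
    rw [effRank_of_isEmpty] at hr
    linarith
  have : NeZero d := ⟨hd⟩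
  have hn' : (0 : ℝ) < n := by exact_mod_cast hl.pos
  have hs := opNorm_pos h.posDef
  have hg : 0 < effRank S ^ 2 - effRank (S ^ 2) :=
    (mul_pos (by linarith) (by linarith)).trans_le (mul_sub_one_le_effRank_sq_sub h.posDef)
  refine (h.one_sub_le_measureReal_sqErr_sub hτ hρ h0 h1 fun _ => hl).trans
    (measureReal_mono fun ω hω => ?_)
  have hω : |sqErr X S ω - meanSqErr P X S| ≤ _ := hω
  rw [mul_left_comm] at hω
  refine (abs_div_sub_one_le (by positivity) hg (h.le_meanSqErr hρ.le hl.pos) hω).trans ?_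
  rw [mul_div_assoc, ← max_div_div_right hg.le]
  refine mul_le_mul_of_nonneg_right hC (le_max_of_le_right ?_)
  exact div_nonneg (by linarith [hl.one_le]) hg.le

/-- The relative error bound in terms of the effective rank of `S` alone. -/
theorem IsRegularSample.one_sub_le_measureReal_div_sub_one'
    (h : IsRegularSample P X μ S τ ρ) (hτ : 0 < τ) (hρ : 0 < ρ) {δ : ℝ} (h0 : 0 < δ) (h1 : δ < 1)
    (hr : 1 < effRank S) (hl : IsLargeSample n τ ρ (effRank S) (Real.log (7 / δ))) {C : ℝ}
    (hC : 4 + 2 * τ * (10 * τ + 5) ≤ C) :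
    1 - δ ≤ P.real {ω | |sqErr X S ω / meanSqErr P X S - 1| ≤
      C * max (√(Real.log (7 / δ)) / (effRank S - 1))
        (Real.log (7 / δ) / (effRank S * (effRank S - 1)))} := by
  have hP := h.prob
  have hd : d ≠ 0 := by
    rintro rfl
    rw [effRank_of_isEmpty] at hr
    linarith
  have : NeZero d := ⟨hd⟩
  have hC0 : 0 ≤ C := le_trans (by positivity) hC
  have hr0 : 0 < effRank S := by linarith
  have hr1 : 0 < effRank S - 1 := by linarith
  have hg := mul_sub_one_le_effRank_sq_sub h.posDef
  have hgp : 0 < effRank S * (effRank S - 1) := mul_pos hr0 hr1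
  have hl0 : 0 ≤ Real.log (7 / δ) := by linarith [hl.one_le]
  refine (h.one_sub_le_measureReal_div_sub_one hτ hρ h0 h1 hr hl hC).trans
    (measureReal_mono fun ω hω => ?_)
  rw [Set.mem_ofPred_eq] at hω ⊢
  refine hω.trans ?_
  refine mul_le_mul_of_nonneg_left (max_le_max ?_ ?_) hC0
  · calc _ ≤ effRank S * √(Real.log (7 / δ)) / (effRank S * (effRank S - 1)) := by
          gcongr
          exact effRank_sq_le h.posDef
      _ = _ := mul_div_mul_left _ _ hr0.ne'
  · gcongr

end Sample

section Sample

variable {d n : ℕ} {Ω : Type*} [MeasurableSpace Ω] {P : Measure Ω}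
  {X : Fin n → Ω → (Fin d → ℝ)} {μ : Measure (Fin d → ℝ)} {S : Matrix (Fin d) (Fin d) ℝ} {τ ρ : ℝ}

/-- For a large effective rank the relative error is of the order of its inverse. -/
theorem IsRegularSample.one_sub_le_measureReal_div_sub_one_of_sqrt_log_le
    (h : IsRegularSample P X μ S τ ρ) (hτ : 0 < τ) (hρ : 0 < ρ) {δ : ℝ} (h0 : 0 < δ) (h1 : δ < 1)
    (hr : 2 ≤ effRank S) (hlr : √(Real.log (7 / δ)) ≤ effRank S)
    (hl : IsLargeSample n τ ρ (effRank S) (Real.log (7 / δ))) :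
    1 - δ ≤ P.real {ω | |sqErr X S ω / meanSqErr P X S - 1| ≤
      2 * (4 + 2 * τ * (10 * τ + 5)) * √(Real.log (7 / δ)) / effRank S} := by
  have hP := h.prob
  have hr0 : 0 < effRank S := by linarith
  have hr1 : 0 < effRank S - 1 := by linarith
  have hl0 : 0 ≤ Real.log (7 / δ) := by linarith [hl.one_le]
  refine (h.one_sub_le_measureReal_div_sub_one' hτ hρ h0 h1 (by linarith) hl le_rfl).trans
    (measureReal_mono fun ω hω => ?_)
  rw [Set.mem_ofPred_eq] at hω ⊢
  refine hω.trans ?_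
  have hκ : 0 < 4 + 2 * τ * (10 * τ + 5) := by positivity
  rw [mul_comm 2 (4 + 2 * τ * (10 * τ + 5)), mul_assoc (4 + 2 * τ * (10 * τ + 5)), mul_div_assoc]
  -- For $r\ge2$, $1/(r-1)\le2/r$; and $\sqrt l\le r\le2(r-1)$ absorbs the term linear in $l$.
  refine mul_le_mul_of_nonneg_left (max_le ?_ ?_) hκ.le
  · rw [div_le_div_iff₀ hr1 hr0]
    nlinarith [Real.sqrt_nonneg (Real.log (7 / δ))]
  · rw [div_le_div_iff₀ (mul_pos hr0 hr1) hr0]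
    have hs := Real.mul_self_sqrt hl0
    set s := √(Real.log (7 / δ))
    have hs0 : 0 ≤ s := Real.sqrt_nonneg _
    calc Real.log (7 / δ) * effRank S = s * effRank S * s := by rw [← hs]; ring
      _ ≤ s * effRank S * (2 * (effRank S - 1)) := by gcongr; linarith
      _ = 2 * s * (effRank S * (effRank S - 1)) := by ring

end Sample

end SampleCov

/-! ### The theorem -/

theorem mainTheorem4 (τ : ℝ) (hτ : 0 < τ) :
    ∃ C : ℝ, 0 < C ∧ ∀ ρ : ℝ, 0 < ρ →
      (∃ c : ℝ, 0 < c ∧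
        ∀ (d n : ℕ) (Ω : Type u) [MeasurableSpace Ω] (P : MeasureTheory.Measure Ω)
          (X : Fin n → Ω → (Fin d → ℝ)) (μ : MeasureTheory.Measure (Fin d → ℝ))
          (S : Matrix (Fin d) (Fin d) ℝ),
          SampleCov.IsRegularSample P X μ S τ ρ →
          MeasureTheory.Integrable (SampleCov.sqErr X S) P ∧
          (1 < SampleCov.effRank S → 0 < SampleCov.meanSqErr P X S) ∧
          ∀ δ : ℝ, 0 < δ → δ < 1 →
            c * (SampleCov.effRank S ^ 6 + SampleCov.effRank S ^ 2 * Real.log (2 / δ) ^ 2) ≤ n →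
            1 - δ ≤ P.real {ω |
              |SampleCov.sqErr X S ω - SampleCov.meanSqErr P X S| ≤
                C * (SampleCov.opNorm S ^ 2 / n *
                  max (SampleCov.effRank (S ^ 2) * Real.sqrt (Real.log (7 / δ)))
                    (Real.log (7 / δ)))} ∧
            (1 < SampleCov.effRank S →
              1 - δ ≤ P.real {ω |
                |SampleCov.sqErr X S ω / SampleCov.meanSqErr P X S - 1| ≤
                  C * max
                    (SampleCov.effRank (S ^ 2) * Real.sqrt (Real.log (7 / δ)) /
                      (SampleCov.effRank S ^ 2 - SampleCov.effRank (S ^ 2)))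
                    (Real.log (7 / δ) /
                      (SampleCov.effRank S ^ 2 - SampleCov.effRank (S ^ 2)))} ∧
              1 - δ ≤ P.real {ω |
                |SampleCov.sqErr X S ω / SampleCov.meanSqErr P X S - 1| ≤
                  C * max
                    (Real.sqrt (Real.log (7 / δ)) / (SampleCov.effRank S - 1))
                    (Real.log (7 / δ) /
                      (SampleCov.effRank S * (SampleCov.effRank S - 1)))})) ∧
      (∀ δ : ℝ, 0 < δ → δ < 1 → ∃ R : ℝ,
        ∀ (d n : ℕ) (Ω : Type u) [MeasurableSpace Ω] (P : MeasureTheory.Measure Ω)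
          (X : Fin n → Ω → (Fin d → ℝ)) (μ : MeasureTheory.Measure (Fin d → ℝ))
          (S : Matrix (Fin d) (Fin d) ℝ),
          SampleCov.IsRegularSample P X μ S τ ρ →
          R ≤ SampleCov.effRank S →
          R ≤ n / SampleCov.effRank S ^ 6 →
          0 < SampleCov.meanSqErr P X S ∧
          1 - δ ≤ P.real {ω |
            |SampleCov.sqErr X S ω / SampleCov.meanSqErr P X S - 1| ≤
              C * Real.sqrt (Real.log (7 / δ)) / SampleCov.effRank S}) := by
  have hκ : 0 < 4 + 2 * τ * (10 * τ + 5) := by positivity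
  -- The factor $2$ serves only the second part, where $\mathtt r(\Sigma)-1$ is replaced by $\mathtt
  -- r(\Sigma)$.
  refine ⟨2 * (4 + 2 * τ * (10 * τ + 5)), by positivity, fun ρ hρ => ?_⟩
  obtain ⟨c, hc, hlarge⟩ := SampleCov.exists_isLargeSample hτ hρ
  refine ⟨⟨c, hc, fun d n Ω _ P X μ S h => ⟨h.integrable_sqErr hρ.le, h.meanSqErr_pos hρ.le,
    fun δ h0 h1 hn => ?_⟩⟩, fun δ h0 h1 => ?_⟩
  · have hP := h.prob
    have hls : d ≠ 0 → SampleCov.IsLargeSample n τ ρ (SampleCov.effRank S) (Real.log (7 / δ)) :=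
      fun hd => by
        have : NeZero d := ⟨hd⟩
        exact hlarge n _ _ _ (SampleCov.one_le_effRank h.posDef)
          (SampleCov.one_le_log_seven_div h0 h1) (SampleCov.log_seven_div_le h0 h1)
          (SampleCov.half_le_log_two_div h0 h1) hn
    refine ⟨(h.one_sub_le_measureReal_sqErr_sub hτ hρ h0 h1 hls).trans
      (MeasureTheory.measureReal_mono fun ω hω => ?_), fun hr => ?_⟩
    · rw [Set.mem_ofPred_eq] at hω ⊢
      rw [mul_assoc]
      linarith [(abs_nonneg _).trans hω]
    · have hd : d ≠ 0 := by
        rintro rfl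
        rw [SampleCov.effRank_of_isEmpty] at hr
        linarith
      exact ⟨h.one_sub_le_measureReal_div_sub_one hτ hρ h0 h1 hr (hls hd) (by linarith),
        h.one_sub_le_measureReal_div_sub_one' hτ hρ h0 h1 hr (hls hd) (by linarith)⟩
  · have hl1 := SampleCov.one_le_log_seven_div h0 h1
    set l' := Real.log (2 / δ) with hl'
    have hcl : 0 < c * (1 + l' ^ 2) := by positivity
    -- The summands ensure, in turn, $\mathtt r(\Sigma)\ge2$, the size condition of the first part
    -- (using $\mathtt r(\Sigma)^2\le\mathtt r(\Sigma)^6$), and $\sqrt{\log(7/\delta)}\le\mathtt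
    -- r(\Sigma)$.
    refine ⟨2 + c * (1 + l' ^ 2) + Real.log (7 / δ), fun d n Ω _ P X μ S h hR hn => ?_⟩
    have hr2 : 2 ≤ SampleCov.effRank S := by linarith
    have hr0 : 0 < SampleCov.effRank S := by linarith
    have hr6 : SampleCov.effRank S ^ 2 ≤ SampleCov.effRank S ^ 6 :=
      pow_le_pow_right₀ (by linarith) (by norm_num)
    rw [le_div_iff₀ (by positivity)] at hn
    have hn' : c * (SampleCov.effRank S ^ 6 + SampleCov.effRank S ^ 2 * l' ^ 2) ≤ n := by
      refine le_trans ?_ hn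
      calc _ ≤ c * (SampleCov.effRank S ^ 6 + SampleCov.effRank S ^ 6 * l' ^ 2) := by gcongr
        _ = c * (1 + l' ^ 2) * SampleCov.effRank S ^ 6 := by ring
        _ ≤ _ := by gcongr; linarith
    refine ⟨h.meanSqErr_pos hρ.le (by linarith), ?_⟩
    refine h.one_sub_le_measureReal_div_sub_one_of_sqrt_log_le hτ hρ h0 h1 hr2 ?_
      (hlarge n _ _ _ (by linarith) hl1 (SampleCov.log_seven_div_le h0 h1)
        (SampleCov.half_le_log_two_div h0 h1) hn')
    have hlr : Real.log (7 / δ) ≤ SampleCov.effRank S := by linarith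
    exact Real.sqrt_le_iff.2 ⟨hr0.le, by nlinarith⟩
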